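/- Let $M$ be a smooth compact Riemannian manifold without boundary, of dimension $d$, with Levi-Civita connection $\nabla$ and Riemannian measure $\nu$; functions are real-valued. **$H$-operators.** A simple $H$-operator is given by a $C^\infty$ diffeomorphism $\Phi:V\to V'$ between open subsets $V,V'\subset M$ and a compactly supported $C^\infty$ function $\varphi:M\to\mathbb R$ with $\operatorname{supp}\varphi\subset V$; it maps $f$ to the function equal to $\varphi(x)f(\Phi(x))$ for $x\in V$ and to $0$ for $x\in M\setminus V$. An operator $T:C(M)\to C(M)$ is an $H$-operator localized on an open set $U$ if it is a finite combination of simple $H$-operators with $V\subset U$ and $\Phi(V)\subset U$. **Smooth decomposition of identity.** Let $\mathcal U$ be an open cover of $M$ and $1\le q<\infty$. A family $\{P_U\}_{U\in\mathcal U}$ is a smooth decomposition of identity in $L^q(M)$ subordinate to $\mathcal U$ if (i) for each compact $K\subset M$ only finitely many $U$ with $U\cap K\ne\emptyset$ have $P_U\neq0$; (ii) each $P_U$ is an $H$-operator localized on $U$; (iii) each $P_U$ extends to a bounded operator on $L^q(M)$ which is a projection; (iv) $P_U\circ P_{U'}=0$ for $U\ne U'$; (v) $\sum_{U}P_U=\mathbf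 I$ unconditionally in the strong operator topology of $L^q(M)$; (vi) there is $C>0$ with $\frac1C\|f\|_q\le\big(\sum_U\|P_Uf\|_q^q\big)^{1/q}\le C\|f\|_q$ for all $f\in L^q(M)$. A smooth decomposition of identity in $C(M)$ (the case $q=\infty$) is defined in the same way with $L^q(M)$ replaced by $C(M)$ and (vi) replaced by: $(\|P_Uf\|_\infty)_{U}\in c_0(\mathcal U)$ and $\frac1C\|f\|_\infty\le\sup_U\|P_Uf\|_\infty\le C\|f\|_\infty$ for all $f\in C(M)$. **Function spaces.** For $r=0,1,\ldots$, $C^r(M)$ is the space of $C^r$ functions on $M$ with the norm $\|f\|_{C^r(M)}=\sum_{k=0}^r\sup_{M}|\nabla^kf|$. For $1\le p<\infty$, $W^r_p(M)$ is the completion of $\{u\in C^\infty(M):\|u\|_{W^r_p}<\infty\}$ in the norm $\|u\|_{W^r_p}=\sum_{k=0}^r\big(\int_M|\nabla^ku|^p\,d\nu\big)^{1/p}$, realized as a subspace of $L^p(M)$: it consists of the $L^p$-limits $f$ of sequences $(u_n)$ of such functions that are Cauchy in $\|\cdot\|_{W^r_p}$, with $\|f\|_{W^r_p}=\lim_n\|u_n\|_{W^r_p}$.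 **Theorem.** Let $\mathcal U$ be a finite open cover of $M$, and let $\{P_U\}_{U\in\mathcal U}$ be a smooth decomposition of identity subordinate to $\mathcal U$, in $L^q(M)$ for some $1\le q<\infty$ or in $C(M)$. Then, for every $1\le p<\infty$, each $P_U$ has a unique extension to a bounded linear operator on $L^p(M)$, again denoted by $P_U$. Let $\mathcal F(M)$ be either $C^r(M)$ or $W^r_p(M)$, with $1\le p<\infty$ and $r=0,1,\ldots$. Then each $P_U$ maps $\mathcal F(M)$ into itself, there is a direct sum decomposition $$\mathcal F(M)=\bigoplus_{U\in\mathcal U}P_U(\mathcal F(M)),$$ in which $f=\sum_{U\in\mathcal U}P_Uf$, and the norms are equivalent: $\|\cdot\|_{\mathcal F(M)}$ is finite on $\mathcal F(M)$, and there is a constant $C>0$ such that $$\frac1C\|f\|_{\mathcal F(M)}\le\sum_{U\in\mathcal U}\|P_Uf\|_{\mathcal F(M)}\le C\|f\|_{\mathcal F(M)}\qquad\text{for all }f\in\mathcal F(M).$$ -/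

import Mathlib

open MeasureTheory Filter Topology Set
open scoped Manifold ContDiff ENNReal NNReal

noncomputable section

namespace HestenesDecomposition

section Riemannian

variable {d : ℕ} {M : Type*} [TopologicalSpace M] [ChartedSpace (EuclideanSpace ℝ (Fin d)) M]
  [IsManifold (𝓡 d) ∞ M]

/-- A smooth Riemannian metric on the `d`-dimensional manifold `M`. -/
abbrev SmoothMetric (d : ℕ) (M : Type*) [TopologicalSpace M]
    [ChartedSpace (EuclideanSpace ℝ (Fin d)) M] [IsManifold (𝓡 d) ∞ M] :=
  Bundle.ContMDiffRiemannianMetric (𝓡 d) ∞ (EuclideanSpace ℝ (Fin d))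
    (fun x : M => TangentSpace (𝓡 d) x)

/-- Partial derivative `∂F/∂y_i` of a function on `ℝ^d`. -/
def partialDeriv (i : Fin d) (F : EuclideanSpace ℝ (Fin d) → ℝ)
    (y : EuclideanSpace ℝ (Fin d)) : ℝ :=
  fderiv ℝ F y (EuclideanSpace.single i 1)

/-- The coordinate vector field `∂_i` of the chart `e`, at the point with coordinates `y`. -/
def coordVector (e : OpenPartialHomeomorph M (EuclideanSpace ℝ (Fin d)))
    (y : EuclideanSpace ℝ (Fin d)) (i : Fin d) : TangentSpace (𝓡 d) (e.symm y) :=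
  mfderiv (𝓡 d) (𝓡 d) e.symm y
    (show TangentSpace (𝓡 d) y from (EuclideanSpace.single i 1 : EuclideanSpace ℝ (Fin d)))

variable (g : SmoothMetric d M)

/-- The matrix `(g_ij)` of the metric in the chart `e`, as a function of the coordinates. -/
def metricMatrix (e : OpenPartialHomeomorph M (EuclideanSpace ℝ (Fin d)))
    (y : EuclideanSpace ℝ (Fin d)) : Matrix (Fin d) (Fin d) ℝ :=
  Matrix.of fun i j => g.inner (e.symm y) (coordVector e y i) (coordVector e y j)

/-- The Christoffel symbol `Γ^a_ij` of the Levi-Civita connection in the chart `e`. -/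
def christoffel (e : OpenPartialHomeomorph M (EuclideanSpace ℝ (Fin d)))
    (y : EuclideanSpace ℝ (Fin d)) (a i j : Fin d) : ℝ :=
  (1 / 2) * ∑ l, (metricMatrix g e y)⁻¹ a l *
    (partialDeriv i (fun z => metricMatrix g e z j l) y
      + partialDeriv j (fun z => metricMatrix g e z i l) y
      - partialDeriv l (fun z => metricMatrix g e z i j) y)

/-- The components `(∇^k f)_{i_1 … i_k}` of the `k`-th covariant derivative of `f` in the chart
`e`, as functions of the coordinates. -/
def covDeriv (e : OpenPartialHomeomorph M (EuclideanSpace ℝ (Fin d))) (f : M → ℝ) :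
    (k : ℕ) → EuclideanSpace ℝ (Fin d) → (Fin k → Fin d) → ℝ
  | 0, y, _ => f (e.symm y)
  | k + 1, y, i =>
      partialDeriv (i 0) (fun z => covDeriv e f k z (Fin.tail i)) y
        - ∑ a, ∑ l, christoffel g e y a (i 0) (Fin.tail i l) *
            covDeriv e f k y (Function.update (Fin.tail i) l a)

/-- The pointwise norm `|∇^k f|(x)`. It does not depend on the chart around `x`, and is computed
here in the preferred one. -/
def covNorm (f : M → ℝ) (k : ℕ) (x : M) : ℝ :=
  let e := chartAt (EuclideanSpace ℝ (Fin d)) x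
  √(∑ i : Fin k → Fin d, ∑ j : Fin k → Fin d,
    (∏ l, (metricMatrix g e (e x))⁻¹ (i l) (j l)) *
      covDeriv g e f k (e x) i * covDeriv g e f k (e x) j)

/-- The norm `∑_{k ≤ r} sup_M |∇^k f|`. -/
def crNorm (r : ℕ) (f : M → ℝ) : ℝ≥0∞ :=
  ∑ k ∈ Finset.range (r + 1), ⨆ x, ENNReal.ofReal (covNorm g f k x)

variable [MeasurableSpace M]

/-- The measure `√(det g) dy` on the domain of the chart `e`, extended by zero to `M`. -/
def chartMeasure (e : OpenPartialHomeomorph M (EuclideanSpace ℝ (Fin d))) : Measure M :=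
  Measure.map e.symm ((volume.restrict e.target).withDensity
    fun y => ENNReal.ofReal √(metricMatrix g e y).det)

/-- The Riemannian measure `ν`: the least measure that dominates `√(det g) dy` in every chart.
As these chart measures agree on overlaps, and as countably many charts cover `M`,
it coincides with `√(det g) dy` on the domain of each chart. -/
def riemannianMeasure : Measure M :=
  ⨆ e ∈ atlas (EuclideanSpace ℝ (Fin d)) M, chartMeasure g e

/-- The norm `∑_{k ≤ r} (∫_M |∇^k u|^p dν)^{1/p}` of a smooth function. -/
def sobolevNormSmooth (r : ℕ) (p : ℝ≥0∞) (u : M → ℝ) : ℝ≥0∞ :=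
  ∑ k ∈ Finset.range (r + 1), eLpNorm (covNorm g u k) p (riemannianMeasure g)

/-- `u` is a sequence of smooth functions of finite `W^r_p` norm, it is Cauchy in this norm,
and it converges to `f` in `L^p`. -/
structure IsSobolevApprox (r : ℕ) (p : ℝ≥0∞) (u : ℕ → M → ℝ)
    (f : Lp ℝ p (riemannianMeasure g)) : Prop where
  smooth : ∀ n, ContMDiff (𝓡 d) 𝓘(ℝ, ℝ) ∞ (u n)
  finite : ∀ n, sobolevNormSmooth g r p (u n) < ⊤
  cauchy : ∀ ε : ℝ≥0∞, 0 < ε → ∃ N, ∀ m ≥ N, ∀ n ≥ N, sobolevNormSmooth g r p (u m - u n) < ε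
  tendsto : Tendsto (fun n => eLpNorm (u n - ⇑f) p (riemannianMeasure g)) atTop (𝓝 0)

/-- The Sobolev space `W^r_p(M)`, the completion of the smooth functions of finite `W^r_p` norm,
realized as usual inside `L^p(M)`: it consists of the `L^p` limits of the sequences of such
functions that are Cauchy in the `W^r_p` norm. -/
def sobolevSpace (r : ℕ) (p : ℝ≥0∞) : Set (Lp ℝ p (riemannianMeasure g)) :=
  {f | ∃ u, IsSobolevApprox g r p u f}

/-- The norm of the completion `W^r_p(M)`: the limit of the norms of an approximating sequence.
The limit is the same for all approximating sequences of `f`, so that the infimum only picks this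
common value. -/
def sobolevNorm (r : ℕ) (p : ℝ≥0∞) (f : Lp ℝ p (riemannianMeasure g)) : ℝ≥0∞ :=
  ⨅ (u : ℕ → M → ℝ) (_ : IsSobolevApprox g r p u f),
    limsup (fun n => sobolevNormSmooth g r p (u n)) atTop

end Riemannian

section Operators

variable {d : ℕ} {M : Type*} [TopologicalSpace M] [ChartedSpace (EuclideanSpace ℝ (Fin d)) M]

/-- The data `(φ, Φ, V)` of a simple `H`-operator: `Φ` is a smooth diffeomorphism from the open
set `V = Φ.source` onto the open set `Φ.target`, and `φ` is smooth with compact support in `V`. -/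
structure SimpleH (d : ℕ) (M : Type*) [TopologicalSpace M]
    [ChartedSpace (EuclideanSpace ℝ (Fin d)) M] where
  φ : M → ℝ
  Φ : OpenPartialHomeomorph M M
  smooth_φ : ContMDiff (𝓡 d) 𝓘(ℝ, ℝ) ∞ φ
  compact_φ : HasCompactSupport φ
  tsupport_φ : tsupport φ ⊆ Φ.source
  smooth_Φ : ContMDiffOn (𝓡 d) (𝓡 d) ∞ Φ Φ.source
  smooth_Φ_symm : ContMDiffOn (𝓡 d) (𝓡 d) ∞ Φ.symm Φ.target

open Classical in
/-- The action of a simple `H`-operator on functions. -/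
def SimpleH.op (H : SimpleH d M) (f : M → ℝ) (x : M) : ℝ :=
  if x ∈ H.Φ.source then H.φ x * f (H.Φ x) else 0

variable (d) in
/-- `T` is an `H`-operator that is localized on `U`: a finite combination of simple `H`-operators
whose diffeomorphisms go from an open subset of `U` to an open subset of `U`. (Coefficients are
absorbed into the functions `φ`.) As `M` is compact in the sequel, `C_0(M)` is `C(M)`. -/
def IsLocalizedHOperator (U : Set M) (T : C(M, ℝ) →ₗ[ℝ] C(M, ℝ)) : Prop :=
  ∃ (n : ℕ) (H : Fin n → SimpleH d M),
    (∀ i, (H i).Φ.source ⊆ U ∧ (H i).Φ.target ⊆ U) ∧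
    ∀ (f : C(M, ℝ)) (x : M), T f x = ∑ i, (H i).op f x

/-- The family is locally finite, and each `P_U` is an `H`-operator localized on `U`. -/
structure IsLocalizedFamily (d : ℕ) {M : Type*} [TopologicalSpace M]
    [ChartedSpace (EuclideanSpace ℝ (Fin d)) M]
    (𝒰 : Set (Set M)) (P : 𝒰 → C(M, ℝ) →ₗ[ℝ] C(M, ℝ)) : Prop where
  locallyFinite : ∀ K : Set M, IsCompact K →
    {U : 𝒰 | ((U : Set M) ∩ K).Nonempty ∧ P U ≠ 0}.Finite
  localized : ∀ U : 𝒰, IsLocalizedHOperator d (U : Set M) (P U)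

/-- A smooth decomposition of identity in `C(M)`, subordinate to the cover `𝒰`. -/
structure IsSmoothDecompositionC (d : ℕ) {M : Type*} [TopologicalSpace M] [CompactSpace M]
    [ChartedSpace (EuclideanSpace ℝ (Fin d)) M]
    (𝒰 : Set (Set M)) (P : 𝒰 → C(M, ℝ) →ₗ[ℝ] C(M, ℝ)) : Prop where
  family : IsLocalizedFamily d 𝒰 P
  proj : ∀ U f, P U (P U f) = P U f
  comp_eq_zero : ∀ U U', U ≠ U' → ∀ f, P U (P U' f) = 0
  hasSum : ∀ f, HasSum (fun U => P U f) f
  tendsto_zero : ∀ f, Tendsto (fun U => ‖P U f‖) cofinite (𝓝 0)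
  norm_equiv : ∃ C : ℝ≥0, 0 < C ∧ ∀ f : C(M, ℝ),
    ‖f‖ₑ ≤ C * ⨆ U, ‖P U f‖ₑ ∧ ⨆ U, ‖P U f‖ₑ ≤ C * ‖f‖ₑ

/-- The bounded operator `A` on `L^p(μ)` extends the operator `T` on `C(M)`. -/
def IsLpExtension [MeasurableSpace M] {μ : Measure M} {p : ℝ≥0∞} [Fact (1 ≤ p)]
    (T : C(M, ℝ) →ₗ[ℝ] C(M, ℝ)) (A : Lp ℝ p μ →L[ℝ] Lp ℝ p μ) : Prop :=
  ∀ (f : C(M, ℝ)) (F : Lp ℝ p μ), F =ᵐ[μ] f → A F =ᵐ[μ] T f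

/-- A smooth decomposition of identity in `L^q(M)`, `1 ≤ q < ∞`, subordinate to the cover `𝒰`:
the operators `P_U` on `L^q(M)` are the bounded extensions of localized `H`-operators. -/
structure IsSmoothDecompositionLp {d : ℕ} {M : Type*} [TopologicalSpace M]
    [ChartedSpace (EuclideanSpace ℝ (Fin d)) M] [IsManifold (𝓡 d) ∞ M] [MeasurableSpace M]
    (g : SmoothMetric d M) (q : ℝ≥0∞) [Fact (1 ≤ q)]
    (𝒰 : Set (Set M)) (P : 𝒰 → C(M, ℝ) →ₗ[ℝ] C(M, ℝ)) : Prop where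
  family : IsLocalizedFamily d 𝒰 P
  extension : ∃ A : 𝒰 → Lp ℝ q (riemannianMeasure g) →L[ℝ] Lp ℝ q (riemannianMeasure g),
    (∀ U, IsLpExtension (P U) (A U)) ∧
    (∀ U F, A U (A U F) = A U F) ∧
    (∀ U U', U ≠ U' → ∀ F, A U (A U' F) = 0) ∧
    (∀ F, HasSum (fun U => A U F) F) ∧
    ∃ C : ℝ≥0, 0 < C ∧ ∀ F,
      ‖F‖ₑ ≤ C * (∑' U, ‖A U F‖ₑ ^ q.toReal) ^ (1 / q.toReal) ∧
      (∑' U, ‖A U F‖ₑ ^ q.toReal) ^ (1 / q.toReal) ≤ C * ‖F‖ₑ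

end Operators

section DirectSum

variable {X : Type*} [AddCommGroup X] [Module ℝ X] {ι : Type*} [Fintype ι]

/-- The set `F` is a linear subspace of `X`, the images `P_i(F)` lie in `F`, and `F` is their
(internal) direct sum, the components of `f ∈ F` being the `P_i f`. -/
def IsDirectSumOfImages (F : Set X) (P : ι → X →ₗ[ℝ] X) : Prop :=
  ∃ S : Submodule ℝ X, (S : Set X) = F ∧
    (∀ i, S.map (P i) ≤ S) ∧
    iSupIndep (fun i => S.map (P i)) ∧
    ⨆ i, S.map (P i) = S ∧
    ∀ f ∈ S, ∑ i, P i f = f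

/-- The norm `N` is finite on `F`, and `N f ≍ ∑ N (P_i f)` for `f ∈ F`. -/
def HasEquivalentNorms (F : Set X) (N : X → ℝ≥0∞) (P : ι → X →ₗ[ℝ] X) : Prop :=
  (∀ f ∈ F, N f < ⊤) ∧
  ∃ C : ℝ≥0, 0 < C ∧ ∀ f ∈ F, N f ≤ C * ∑ i, N (P i f) ∧ ∑ i, N (P i f) ≤ C * N f

end DirectSum

/-- The space `C^r(M)`, for compact `M`, as a set of continuous functions. -/
def crSpace (d : ℕ) (M : Type*) [TopologicalSpace M] [ChartedSpace (EuclideanSpace ℝ (Fin d)) M]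
    (r : ℕ) : Set C(M, ℝ) :=
  {f | ContMDiff (𝓡 d) 𝓘(ℝ, ℝ) r f}

end HestenesDecomposition

end

/-! An H-operator is a multiplication composed with a diffeomorphism, so it loses no derivatives. In
charts, the product and chain rules express the components of `∇^k(φ · f ∘ Φ)` as combinations, with
smooth coefficients, of the components of `∇^m f`, `m ≤ k`, at `Φ x` (`isComb_genCov_mul_comp`). As
`φ` has compact support inside the domain of `Φ`, finitely many local bounds give `|∇^k(Hf)|(x) ≤ C
∑_{m ≤ k} |∇^m f|(Φ x)` on that support (`SimpleH.exists_covNorm_op_le`). Suprema yield boundedness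
in `C^r`. For `L^p` norms one also needs that `Φ` distorts the Riemannian measure by a bounded
factor on compact sets (`exists_measure_inter_preimage_le`).

The case `r = 0` and the density of `C(M)` give the unique extensions to `L^p`. For general `r` the
operators send sequences that are Cauchy in the Sobolev norm to such sequences, so the extensions
act boundedly on `W^r_p`. The relations `P_U² = P_U`, `P_U P_U' = 0`, `∑ P_U = I` pass from `L^q` to
`C(M)` because the measure charges nonempty open sets, which makes `C(M) → L^q` injective
(`continuous_relations_of_lp`), and from `C(M)` to every `L^p` by density (`lp_relations`). The
direct sum is then algebra, and the norm equivalence is the triangle inequality together with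
boundedness of finitely many operators.

Most of the labour comes from the coordinate definitions. The norm `|∇^k f|(x)` uses the preferred
chart at `x`, which may jump with `x`, and the Riemannian measure is a supremum of chart measures.
Chart independence is therefore proved classically: the transformation law of Christoffel symbols
(`metricConnection_pullback`), the tensor law for covariant derivatives (`genCov_comp_eq_tens`),
invariance of the norm (`covNorm_eq`), and comparison of chart measures by change of variables
(`riemannianMeasure_le_chartMeasure`). -/

noncomputable section

namespace HestenesDecomposition

/-! ### Coordinate covariant derivatives for an arbitrary connection -/

section Euclidean

variable {d : ℕ}

/-- The coordinate space. -/
abbrev Euc (d : ℕ) := EuclideanSpace ℝ (Fin d)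

/-- Connection coefficients `Γ^a_ij` on an open set of the coordinate space. -/
abbrev Connection (d : ℕ) := Euc d → Fin d → Fin d → Fin d → ℝ

theorem partialDeriv_add {F H : Euc d → ℝ} {y : Euc d} (i : Fin d)
    (hF : DifferentiableAt ℝ F y) (hH : DifferentiableAt ℝ H y) :
    partialDeriv i (fun z => F z + H z) y = partialDeriv i F y + partialDeriv i H y := by
  simp [partialDeriv, fderiv_fun_add hF hH]

theorem partialDeriv_const_mul {F : Euc d → ℝ} {y : Euc d} (i : Fin d) (c : ℝ)
    (hF : DifferentiableAt ℝ F y) :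
    partialDeriv i (fun z => c * F z) y = c * partialDeriv i F y := by
  simp [partialDeriv, fderiv_const_mul hF c]

theorem partialDeriv_sum {ι : Type*} {s : Finset ι} {F : ι → Euc d → ℝ} {y : Euc d} (i : Fin d)
    (hF : ∀ a ∈ s, DifferentiableAt ℝ (F a) y) :
    partialDeriv i (fun z => ∑ a ∈ s, F a z) y = ∑ a ∈ s, partialDeriv i (F a) y := by
  simp [partialDeriv, fderiv_fun_sum hF]

theorem partialDeriv_mul {F H : Euc d → ℝ} {y : Euc d} (i : Fin d)
    (hF : DifferentiableAt ℝ F y) (hH : DifferentiableAt ℝ H y) :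
    partialDeriv i (fun z => F z * H z) y =
      partialDeriv i F y * H y + F y * partialDeriv i H y := by
  simp [partialDeriv, fderiv_fun_mul hF hH]
  ring

theorem partialDeriv_congr {F H : Euc d → ℝ} {y : Euc d} (i : Fin d) (h : F =ᶠ[𝓝 y] H) :
    partialDeriv i F y = partialDeriv i H y := by
  simp [partialDeriv, h.fderiv_eq]

theorem partialDeriv_comp {F : Euc d → ℝ} {Ψ : Euc d → Euc d} {y : Euc d} (i : Fin d)
    (hF : DifferentiableAt ℝ F (Ψ y)) (hΨ : DifferentiableAt ℝ Ψ y) :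
    partialDeriv i (fun z => F (Ψ z)) y =
      ∑ b, partialDeriv b F (Ψ y) * partialDeriv i (fun z => Ψ z b) y := by
  have h1 : fderiv ℝ (fun z => F (Ψ z)) y = (fderiv ℝ F (Ψ y)).comp (fderiv ℝ Ψ y) :=
    fderiv_comp y hF hΨ
  have h2 : ∀ b, partialDeriv i (fun z => Ψ z b) y = (fderiv ℝ Ψ y (EuclideanSpace.single i 1)) b := by
    intro b
    have : HasFDerivAt (fun z => Ψ z b)
        ((EuclideanSpace.proj b : Euc d →L[ℝ] ℝ).comp (fderiv ℝ Ψ y)) y :=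
      (EuclideanSpace.proj b : Euc d →L[ℝ] ℝ).hasFDerivAt.comp y
        hΨ.hasFDerivAt
    simp [partialDeriv, this.fderiv]
  simp only [h2]
  set v := fderiv ℝ Ψ y (EuclideanSpace.single i 1) with hv
  have h3 : v = ∑ b, v b • (EuclideanSpace.single b (1 : ℝ) : Euc d) := by
    ext a
    simp [Pi.single_apply]
  rw [partialDeriv, h1, ContinuousLinearMap.comp_apply, ← hv]
  conv_lhs => rw [h3]
  simp [partialDeriv, mul_comm]

theorem contDiffOn_partialDeriv {n m : ℕ∞ω} {F : Euc d → ℝ} {Ω : Set (Euc d)}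
    (hΩ : IsOpen Ω) (hF : ContDiffOn ℝ n F Ω) (hm : m + 1 ≤ n) (i : Fin d) :
    ContDiffOn ℝ m (partialDeriv i F) Ω :=
  (hF.fderiv_of_isOpen hΩ hm).clm_apply contDiffOn_const

/-- The components of the `k`-th covariant derivative for the connection `Γ`. -/
def genCov (Γ : Connection d) (F : Euc d → ℝ) : (k : ℕ) → Euc d → (Fin k → Fin d) → ℝ
  | 0, y, _ => F y
  | k + 1, y, i =>
      partialDeriv (i 0) (fun z => genCov Γ F k z (Fin.tail i)) y
        - ∑ a, ∑ l, Γ y a (i 0) (Fin.tail i l) *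
            genCov Γ F k y (Function.update (Fin.tail i) l a)

theorem genCov_congr {Γ : Connection d} {F H : Euc d → ℝ} {Ω : Set (Euc d)} (hΩ : IsOpen Ω)
    (h : EqOn F H Ω) (k : ℕ) {y : Euc d} (hy : y ∈ Ω) (i : Fin k → Fin d) :
    genCov Γ F k y i = genCov Γ H k y i := by
  induction k generalizing y with
  | zero => exact h hy
  | succ k ih =>
    simp only [genCov]
    congr 1
    · exact partialDeriv_congr _ (by filter_upwards [hΩ.mem_nhds hy] with z hz using ih hz _)
    · simp only [ih hy]

variable {Γ : Connection d} {Ω : Set (Euc d)}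

/-- Each covariant derivative costs one degree of smoothness; `m` is the smoothness that remains,
and it must vary in the induction because the recursion differentiates components of class `m + 1`.
-/
theorem contDiffOn_genCov (hΩ : IsOpen Ω)
    (hΓ : ∀ a i j, ContDiffOn ℝ ∞ (fun y => Γ y a i j) Ω) {F : Euc d → ℝ} (k m : ℕ)
    (hF : ContDiffOn ℝ ((m + k : ℕ) : ℕ∞ω) F Ω) (i : Fin k → Fin d) :
    ContDiffOn ℝ m (fun y => genCov Γ F k y i) Ω := by
  induction k generalizing m with
  | zero => simpa [genCov] using hF
  | succ k ih =>
    simp only [genCov]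
    have h1 : ∀ j, ContDiffOn ℝ ((m + 1 : ℕ) : ℕ∞ω) (fun y => genCov Γ F k y j) Ω := fun j =>
      ih (m + 1) (by rwa [show m + 1 + k = m + (k + 1) by ring]) j
    refine (contDiffOn_partialDeriv hΩ (h1 _) (by norm_cast) _).sub ?_
    refine ContDiffOn.sum fun a _ => ContDiffOn.sum fun l _ => ContDiffOn.mul ?_ ?_
    · exact (hΓ _ _ _).of_le (by exact_mod_cast le_top)
    · exact (h1 _).of_le (by exact_mod_cast Nat.le_succ m)

theorem differentiableAt_genCov (hΩ : IsOpen Ω)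
    (hΓ : ∀ a i j, ContDiffOn ℝ ∞ (fun y => Γ y a i j) Ω) {F : Euc d → ℝ} {k n : ℕ} (hk : k + 1 ≤ n)
    (hF : ContDiffOn ℝ n F Ω) {y : Euc d} (hy : y ∈ Ω) (i : Fin k → Fin d) :
    DifferentiableAt ℝ (fun y => genCov Γ F k y i) y :=
  ((contDiffOn_genCov hΩ hΓ k 1 (hF.of_le (by exact_mod_cast (by omega))) i).contDiffAt
    (hΩ.mem_nhds hy)).differentiableAt (by simp)

theorem genCov_add (hΩ : IsOpen Ω)
    (hΓ : ∀ a i j, ContDiffOn ℝ ∞ (fun y => Γ y a i j) Ω) {F H : Euc d → ℝ} {k : ℕ}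
    (hF : ContDiffOn ℝ k F Ω) (hH : ContDiffOn ℝ k H Ω) {y : Euc d} (hy : y ∈ Ω)
    (i : Fin k → Fin d) :
    genCov Γ (fun z => F z + H z) k y i = genCov Γ F k y i + genCov Γ H k y i := by
  induction k generalizing y with
  | zero => rfl
  | succ k ih =>
    have hF' := hF.of_le (show ((k : ℕ) : ℕ∞ω) ≤ ((k + 1 : ℕ) : ℕ∞ω) by exact_mod_cast Nat.le_succ k)
    have hH' := hH.of_le (show ((k : ℕ) : ℕ∞ω) ≤ ((k + 1 : ℕ) : ℕ∞ω) by exact_mod_cast Nat.le_succ k)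
    simp only [genCov]
    rw [partialDeriv_congr (H := fun z => genCov Γ F k z (Fin.tail i) + genCov Γ H k z (Fin.tail i)) _
        (by filter_upwards [hΩ.mem_nhds hy] with z hz using ih hF' hH' hz _),
      partialDeriv_add _ (differentiableAt_genCov hΩ hΓ le_rfl hF hy _)
        (differentiableAt_genCov hΩ hΓ le_rfl hH hy _)]
    simp only [ih hF' hH' hy, mul_add, Finset.sum_add_distrib]
    ring

theorem genCov_const_mul (hΩ : IsOpen Ω)
    (hΓ : ∀ a i j, ContDiffOn ℝ ∞ (fun y => Γ y a i j) Ω) {F : Euc d → ℝ} {k : ℕ} (c : ℝ)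
    (hF : ContDiffOn ℝ k F Ω) {y : Euc d} (hy : y ∈ Ω) (i : Fin k → Fin d) :
    genCov Γ (fun z => c * F z) k y i = c * genCov Γ F k y i := by
  induction k generalizing y with
  | zero => rfl
  | succ k ih =>
    have hF' := hF.of_le (show ((k : ℕ) : ℕ∞ω) ≤ ((k + 1 : ℕ) : ℕ∞ω) by exact_mod_cast Nat.le_succ k)
    simp only [genCov]
    rw [partialDeriv_congr (H := fun z => c * genCov Γ F k z (Fin.tail i)) _
        (by filter_upwards [hΩ.mem_nhds hy] with z hz using ih hF' hz _),
      partialDeriv_const_mul _ _ (differentiableAt_genCov hΩ hΓ le_rfl hF hy _)]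
    simp only [ih hF' hy, mul_sub, Finset.mul_sum]
    congr 1
    refine Finset.sum_congr rfl fun a _ => Finset.sum_congr rfl fun l _ => by ring

/-! ### Smooth combinations of covariant derivatives -/

/-- `L F` is, on `Ω`, a combination with smooth coefficients of the components of the covariant
derivatives of `F` of order at most `k`, evaluated along `Ψ`. -/
def IsComb (Γ : Connection d) (Ψ : Euc d → Euc d) (Ω Ω' : Set (Euc d)) (k : ℕ)
    (L : (Euc d → ℝ) → Euc d → ℝ) : Prop :=
  ∃ c : (m : ℕ) → (Fin m → Fin d) → Euc d → ℝ, (∀ m j, ContDiffOn ℝ ∞ (c m j) Ω) ∧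
    ∀ F, ContDiffOn ℝ k F Ω' → ∀ y ∈ Ω,
      L F y = ∑ m ∈ Finset.range (k + 1), ∑ j, c m j y * genCov Γ F m (Ψ y) j

variable {Ψ : Euc d → Euc d} {Ω' : Set (Euc d)} {k : ℕ} {L L' : (Euc d → ℝ) → Euc d → ℝ}

theorem IsComb.congr (h : IsComb Γ Ψ Ω Ω' k L)
    (hL : ∀ F, ContDiffOn ℝ k F Ω' → ∀ y ∈ Ω, L' F y = L F y) : IsComb Γ Ψ Ω Ω' k L' := by
  obtain ⟨c, hc, h⟩ := h
  exact ⟨c, hc, fun F hF y hy => (hL F hF y hy).trans (h F hF y hy)⟩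

theorem IsComb.zero : IsComb Γ Ψ Ω Ω' k fun _ _ => 0 :=
  ⟨fun _ _ _ => 0, fun _ _ => contDiffOn_const, by simp⟩

theorem IsComb.add (h : IsComb Γ Ψ Ω Ω' k L) (h' : IsComb Γ Ψ Ω Ω' k L') :
    IsComb Γ Ψ Ω Ω' k fun F y => L F y + L' F y := by
  obtain ⟨c, hc, h⟩ := h
  obtain ⟨c', hc', h'⟩ := h'
  refine ⟨fun m j y => c m j y + c' m j y, fun m j => (hc m j).add (hc' m j), fun F hF y hy => ?_⟩
  simp only [h F hF y hy, h' F hF y hy, add_mul, Finset.sum_add_distrib]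

theorem IsComb.mul {a : Euc d → ℝ} (h : IsComb Γ Ψ Ω Ω' k L) (ha : ContDiffOn ℝ ∞ a Ω) :
    IsComb Γ Ψ Ω Ω' k fun F y => a y * L F y := by
  obtain ⟨c, hc, h⟩ := h
  refine ⟨fun m j y => a y * c m j y, fun m j => ha.mul (hc m j), fun F hF y hy => ?_⟩
  simp only [h F hF y hy, Finset.mul_sum, mul_assoc]

theorem IsComb.sum {ι : Type*} {s : Finset ι} {L : ι → (Euc d → ℝ) → Euc d → ℝ}
    (h : ∀ a ∈ s, IsComb Γ Ψ Ω Ω' k (L a)) : IsComb Γ Ψ Ω Ω' k fun F y => ∑ a ∈ s, L a F y := by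
  classical
  induction s using Finset.induction_on with
  | empty => simpa using IsComb.zero
  | insert a s ha ih =>
    simp only [Finset.sum_insert ha]
    exact (h a (by simp)).add (ih fun b hb => h b (by simp [hb]))

theorem IsComb.of_genCov {m : ℕ} (hm : m ≤ k) (j : Fin m → Fin d) :
    IsComb Γ Ψ Ω Ω' k fun F y => genCov Γ F m (Ψ y) j := by
  classical
  -- The coefficients are a Kronecker delta, taken on pairs (length, multi-index) because
  -- multi-indices of different lengths are compared.
  refine ⟨fun m' j' _ => if (⟨m', j'⟩ : Σ m, Fin m → Fin d) = ⟨m, j⟩ then 1 else 0,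
    fun _ _ => contDiffOn_const, fun F _ y _ => ?_⟩
  rw [Finset.sum_eq_single m, Finset.sum_eq_single j]
  · simp
  · intro j' _ hj
    simp [hj]
  · simp
  · intro m' _ hm'
    refine Finset.sum_eq_zero fun j' _ => ?_
    simp [hm']
  · intro h
    exact absurd (Finset.mem_range.2 (by omega)) h

theorem IsComb.mono {k' : ℕ} (h : IsComb Γ Ψ Ω Ω' k L) (hk : k ≤ k') : IsComb Γ Ψ Ω Ω' k' L := by
  obtain ⟨c, hc, h⟩ := h
  refine IsComb.congr (IsComb.sum (s := Finset.range (k + 1)) fun m hm =>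
    IsComb.sum (s := Finset.univ) fun j _ =>
      (IsComb.of_genCov (by simp at hm; omega) j).mul (hc m j)) fun F hF y hy => ?_
  exact h F (hF.of_le (by exact_mod_cast hk)) y hy

/-- The definition of the covariant derivative is read backwards: `∂_b` of a component of `∇^m F`
equals a component of `∇^{m+1} F` plus Christoffel terms in `∇^m F`. Plain partial derivatives of
`F` thus never appear, and differentiation raises the order by one only. -/
theorem IsComb.pderiv (hΩ : IsOpen Ω) (hΩ' : IsOpen Ω')
    (hΓ : ∀ a i j, ContDiffOn ℝ ∞ (fun y => Γ y a i j) Ω')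
    (hΨ : ContDiffOn ℝ ∞ Ψ Ω) (hm : MapsTo Ψ Ω Ω') (h : IsComb Γ Ψ Ω Ω' k L) (i : Fin d) :
    IsComb Γ Ψ Ω Ω' (k + 1) fun F y => partialDeriv i (L F) y := by
  obtain ⟨c, hc, h⟩ := h
  have hΨc : ∀ b, ContDiffOn ℝ ∞ (fun z => Ψ z b) Ω := fun b =>
    (EuclideanSpace.proj b : Euc d →L[ℝ] ℝ).contDiff.comp_contDiffOn hΨ
  have hdΨ : ∀ b, ContDiffOn ℝ ∞ (partialDeriv i (fun z => Ψ z b)) Ω := fun b =>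
    contDiffOn_partialDeriv hΩ (hΨc b) (by simp) i
  have hterm : ∀ m ∈ Finset.range (k + 1), ∀ j ∈ (Finset.univ : Finset (Fin m → Fin d)),
      IsComb Γ Ψ Ω Ω' (k + 1) fun F y =>
        partialDeriv i (c m j) y * genCov Γ F m (Ψ y) j +
          c m j y * ∑ b, partialDeriv i (fun z => Ψ z b) y *
            (genCov Γ F (m + 1) (Ψ y) (Fin.cons b j) +
              ∑ a, ∑ l, Γ (Ψ y) a b (j l) *
                genCov Γ F m (Ψ y) (Function.update j l a)) := by
    intro m hm' j _
    simp only [Finset.mem_range] at hm'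
    refine IsComb.add ((IsComb.of_genCov (by omega) j).mul (contDiffOn_partialDeriv hΩ (hc m j) (by simp) i))
      (IsComb.mul (IsComb.sum fun b _ => IsComb.mul (IsComb.add (IsComb.of_genCov (by omega) _)
        (IsComb.sum fun a _ => IsComb.sum fun l _ => (IsComb.of_genCov (by omega) _).mul ?_)) (hdΨ b)) (hc m j))
    exact (hΓ a b (j l)).comp hΨ hm
  refine IsComb.congr (IsComb.sum fun m hm => IsComb.sum (hterm m hm)) fun F hF y hy => ?_
  have hF' : ContDiffOn ℝ k F Ω' := hF.of_le (by exact_mod_cast Nat.le_succ k)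
  have hΨy : DifferentiableAt ℝ Ψ y :=
    (hΨ.contDiffAt (hΩ.mem_nhds hy)).differentiableAt (by simp)
  have hgen : ∀ m ∈ Finset.range (k + 1), ∀ j : Fin m → Fin d,
      DifferentiableAt ℝ (fun z => genCov Γ F m z j) (Ψ y) := fun m hm' j =>
    differentiableAt_genCov hΩ' hΓ (by simp at hm'; omega) hF (hm hy) j
  have hcd : ∀ m j, DifferentiableAt ℝ (c m j) y := fun m j =>
    ((hc m j).contDiffAt (hΩ.mem_nhds hy)).differentiableAt (by simp)
  have hcomp : ∀ m ∈ Finset.range (k + 1), ∀ j : Fin m → Fin d,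
      DifferentiableAt ℝ (fun z => genCov Γ F m (Ψ z) j) y := fun m hm' j =>
    (hgen m hm' j).comp y hΨy
  rw [partialDeriv_congr (H := fun y => ∑ m ∈ Finset.range (k + 1), ∑ j, c m j y *
      genCov Γ F m (Ψ y) j) i
      (by filter_upwards [hΩ.mem_nhds hy] with z hz using h F hF' z hz),
    partialDeriv_sum i fun m hm' => DifferentiableAt.fun_sum fun j _ => (hcd m j).fun_mul (hcomp m hm' j)]
  refine Finset.sum_congr rfl fun m hm' => ?_
  rw [partialDeriv_sum i fun j _ => (hcd m j).fun_mul (hcomp m hm' j)]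
  refine Finset.sum_congr rfl fun j _ => ?_
  rw [partialDeriv_mul i (hcd m j) (hcomp m hm' j), partialDeriv_comp i (hgen m hm' j) hΨy]
  congr 2
  refine Finset.sum_congr rfl fun b _ => ?_
  simp [genCov, Fin.tail_cons, mul_comm]

/-- Covariant derivatives of `a · F ∘ Ψ` are combinations of covariant derivatives of `F`. -/
theorem isComb_genCov_mul_comp {Γ₁ : Connection d} (hΩ : IsOpen Ω) (hΩ' : IsOpen Ω')
    (hΓ₁ : ∀ a i j, ContDiffOn ℝ ∞ (fun y => Γ₁ y a i j) Ω)
    (hΓ : ∀ a i j, ContDiffOn ℝ ∞ (fun y => Γ y a i j) Ω')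
    (hΨ : ContDiffOn ℝ ∞ Ψ Ω) (hm : MapsTo Ψ Ω Ω') {a : Euc d → ℝ} (ha : ContDiffOn ℝ ∞ a Ω)
    (k : ℕ) (i : Fin k → Fin d) :
    IsComb Γ Ψ Ω Ω' k fun F y => genCov Γ₁ (fun z => a z * F (Ψ z)) k y i := by
  induction k with
  | zero => exact IsComb.mul (IsComb.of_genCov (Γ := Γ) le_rfl (fun j : Fin 0 => j.elim0)) ha
  | succ k ih =>
    -- Two connections are at work: `Γ₁`, downstairs, enters only through smooth coefficients, while
    -- `Γ` is the one used to differentiate `F`.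
    refine IsComb.congr (((ih (Fin.tail i)).pderiv hΩ hΩ' hΓ hΨ hm (i 0)).add
      (IsComb.sum (s := Finset.univ) fun b _ => IsComb.sum (s := Finset.univ) fun l _ =>
        (((ih (Function.update (Fin.tail i) l b)).mono (Nat.le_succ k)).mul
          (hΓ₁ b (i 0) (Fin.tail i l)).neg))) fun F hF y hy => ?_
    simp [genCov, sub_eq_add_neg]

end Euclidean

/-! ### Pointwise norms of covariant tensors -/

section Tensor

variable {d k : ℕ}

/-- The action of a matrix on the components of a covariant tensor. -/
def tens (A : Matrix (Fin d) (Fin d) ℝ) (T : (Fin k → Fin d) → ℝ) (m : Fin k → Fin d) : ℝ :=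
  ∑ i, (∏ l, A (m l) (i l)) * T i

theorem tens_mul (A B : Matrix (Fin d) (Fin d) ℝ) (T : (Fin k → Fin d) → ℝ) :
    tens (A * B) T = tens A (tens B T) := by
  ext m
  have h : ∀ i : Fin k → Fin d, ∏ l, (A * B) (m l) (i l) =
      ∑ j : Fin k → Fin d, (∏ l, A (m l) (j l)) * ∏ l, B (j l) (i l) := by
    intro i
    simp only [Matrix.mul_apply, Finset.prod_univ_sum, Fintype.piFinset_univ,
      Finset.prod_mul_distrib]
  simp only [tens, h, Finset.sum_mul, Finset.mul_sum, mul_assoc]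
  exact Finset.sum_comm

theorem tens_one (T : (Fin k → Fin d) → ℝ) : tens 1 T = T := by
  classical
  ext m
  rw [tens, Finset.sum_eq_single m]
  · simp
  · intro i _ hi
    obtain ⟨l, hl⟩ := Function.ne_iff.1 hi
    rw [Finset.prod_eq_zero (Finset.mem_univ l) (by rw [Matrix.one_apply, if_neg (Ne.symm hl)]), zero_mul]
  · simp

theorem tens_add (A : Matrix (Fin d) (Fin d) ℝ) (S T : (Fin k → Fin d) → ℝ) :
    tens A (S + T) = tens A S + tens A T := by
  ext m
  simp [tens, mul_add, Finset.sum_add_distrib]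

theorem sum_mul_tens_transpose (A : Matrix (Fin d) (Fin d) ℝ) (S T : (Fin k → Fin d) → ℝ) :
    ∑ i, T i * tens A.transpose S i = ∑ m, tens A T m * S m := by
  simp only [tens, Finset.mul_sum, Finset.sum_mul, Matrix.transpose_apply]
  rw [Finset.sum_comm]
  exact Finset.sum_congr rfl fun m _ => Finset.sum_congr rfl fun i _ => by ring

/-- The norm, for the metric with matrix `G`, of a covariant tensor with components `T`. -/
def tensorNorm (G : Matrix (Fin d) (Fin d) ℝ) (T : (Fin k → Fin d) → ℝ) : ℝ :=
  √(∑ i : Fin k → Fin d, ∑ j : Fin k → Fin d, (∏ l, G⁻¹ (i l) (j l)) * T i * T j)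

/-- A factorization of the inverse metric amounts to an orthonormal frame, in which the tensor norm
is the Euclidean norm of the array of components. All properties of the norm below are read off in
such a frame. -/
theorem tensorNorm_eq_of_inv {G A : Matrix (Fin d) (Fin d) ℝ} (h : G⁻¹ = A.transpose * A)
    (T : (Fin k → Fin d) → ℝ) : tensorNorm G T = √(∑ m, tens A T m ^ 2) := by
  have h1 : ∑ i : Fin k → Fin d, ∑ j : Fin k → Fin d, (∏ l, G⁻¹ (i l) (j l)) * T i * T j =
      ∑ i, T i * tens G⁻¹ T i := by
    refine Finset.sum_congr rfl fun i _ => ?_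
    rw [tens, Finset.mul_sum]
    exact Finset.sum_congr rfl fun j _ => by ring
  rw [tensorNorm, h1, h, tens_mul, sum_mul_tens_transpose]
  simp only [sq]

open scoped MatrixOrder in
theorem exists_eq_transpose_mul_self {G : Matrix (Fin d) (Fin d) ℝ} (hG : G.PosDef) :
    ∃ B : Matrix (Fin d) (Fin d) ℝ, IsUnit B.det ∧ G = B.transpose * B := by
  obtain ⟨B, hB⟩ := CStarAlgebra.nonneg_iff_eq_star_mul_self.mp hG.posSemidef.nonneg
  rw [Matrix.star_eq_conjTranspose, Matrix.conjTranspose_eq_transpose_of_trivial] at hB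
  refine ⟨B, ?_, hB⟩
  have h := hG.det_pos
  rw [hB, Matrix.det_mul, Matrix.det_transpose] at h
  exact isUnit_iff_ne_zero.2 fun h0 => by simp [h0] at h

theorem inv_transpose_mul_self {B : Matrix (Fin d) (Fin d) ℝ} :
    (B.transpose * B)⁻¹ = (B⁻¹.transpose).transpose * B⁻¹.transpose := by
  rw [Matrix.mul_inv_rev, Matrix.transpose_transpose, Matrix.transpose_nonsing_inv]

theorem tensorNorm_transpose_mul_self {B : Matrix (Fin d) (Fin d) ℝ} (T : (Fin k → Fin d) → ℝ) :
    tensorNorm (B.transpose * B) T = √(∑ m, tens B⁻¹.transpose T m ^ 2) :=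
  tensorNorm_eq_of_inv inv_transpose_mul_self T

theorem tensorNorm_add_le {G : Matrix (Fin d) (Fin d) ℝ} (hG : G.PosDef)
    (S T : (Fin k → Fin d) → ℝ) : tensorNorm G (S + T) ≤ tensorNorm G S + tensorNorm G T := by
  obtain ⟨B, -, rfl⟩ := exists_eq_transpose_mul_self hG
  simp only [tensorNorm_transpose_mul_self, tens_add]
  have h := norm_add_le (WithLp.toLp 2 (tens B⁻¹.transpose S)) (WithLp.toLp 2 (tens B⁻¹.transpose T))
  simpa [EuclideanSpace.norm_eq] using h

theorem tensorNorm_smul (G : Matrix (Fin d) (Fin d) ℝ) (c : ℝ) (T : (Fin k → Fin d) → ℝ) :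
    tensorNorm G (c • T) = |c| * tensorNorm G T := by
  rw [tensorNorm, tensorNorm, ← Real.sqrt_sq_eq_abs, ← Real.sqrt_mul (sq_nonneg c), Finset.mul_sum]
  congr 1
  refine Finset.sum_congr rfl fun i _ => ?_
  rw [Finset.mul_sum]
  refine Finset.sum_congr rfl fun j _ => ?_
  simp only [Pi.smul_apply, smul_eq_mul]
  ring

/-- If `G = BᵀB`, then `BJ` factors the pulled back metric, and `(BJ)⁻ᵀ Jᵀ T = B⁻ᵀ T`: in adapted
frames both tensors have the same components. -/
theorem tensorNorm_pullback {G : Matrix (Fin d) (Fin d) ℝ} (hG : G.PosDef)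
    {J : Matrix (Fin d) (Fin d) ℝ} (hJ : IsUnit J.det) (T : (Fin k → Fin d) → ℝ) :
    tensorNorm (J.transpose * G * J) (tens J.transpose T) = tensorNorm G T := by
  obtain ⟨B, -, rfl⟩ := exists_eq_transpose_mul_self hG
  have h : J.transpose * (B.transpose * B) * J = (B * J).transpose * (B * J) := by
    simp only [Matrix.transpose_mul, Matrix.mul_assoc]
  rw [h, tensorNorm_transpose_mul_self, tensorNorm_transpose_mul_self, ← tens_mul,
    ← Matrix.transpose_mul, Matrix.mul_inv_rev, ← Matrix.mul_assoc, Matrix.mul_nonsing_inv _ hJ,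
    Matrix.one_mul]

/-- A component is the tensor evaluated on coordinate vectors, whose squared lengths are the
diagonal entries of `G`; in an orthonormal frame this is the Cauchy–Schwarz inequality. -/
theorem sq_le_prod_mul_tensorNorm_sq {G : Matrix (Fin d) (Fin d) ℝ} (hG : G.PosDef)
    (T : (Fin k → Fin d) → ℝ) (i : Fin k → Fin d) :
    T i ^ 2 ≤ (∏ l, G (i l) (i l)) * tensorNorm G T ^ 2 := by
  obtain ⟨B, hB, rfl⟩ := exists_eq_transpose_mul_self hG
  have h1 : T i = tens B.transpose (tens B⁻¹.transpose T) i := by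
    rw [← tens_mul, ← Matrix.transpose_mul, Matrix.nonsing_inv_mul _ hB, Matrix.transpose_one,
      tens_one]
  have h2 : ∏ l, (B.transpose * B) (i l) (i l) = ∑ m : Fin k → Fin d, (∏ l, B (m l) (i l)) ^ 2 := by
    simp only [Matrix.mul_apply, Finset.prod_univ_sum, Fintype.piFinset_univ,
      Finset.prod_mul_distrib, Matrix.transpose_apply, sq]
  rw [tensorNorm_transpose_mul_self, Real.sq_sqrt (Finset.sum_nonneg fun _ _ => sq_nonneg _), h2, h1]
  exact Finset.sum_mul_sq_le_sq_mul_sq _ _ _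

theorem tensorNorm_le_of_inv_le {G : Matrix (Fin d) (Fin d) ℝ} {b : ℝ}
    (hb : ∀ i j, |G⁻¹ i j| ≤ b) (T : (Fin k → Fin d) → ℝ) :
    tensorNorm G T ≤ √(b ^ k) * ∑ i, |T i| := by
  -- Without multi-indices (`d = 0 < k`) the sign of `b` is unknown, but both sides vanish.
  -- Otherwise either `k = 0`, or an entry of the inverse matrix shows `b ≥ 0`.
  rcases isEmpty_or_nonempty (Fin k → Fin d) with h | ⟨⟨i₀⟩⟩
  · simp [tensorNorm]
  have hb0 : 0 ≤ b ^ k := by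
    rcases Nat.eq_zero_or_pos k with rfl | hk
    · simp
    · exact pow_nonneg ((abs_nonneg _).trans (hb (i₀ ⟨0, hk⟩) (i₀ ⟨0, hk⟩))) k
  rw [tensorNorm, ← Real.sqrt_sq (Finset.sum_nonneg fun i _ => abs_nonneg (T i)),
    ← Real.sqrt_mul hb0]
  refine Real.sqrt_le_sqrt ?_
  rw [sq, Finset.sum_mul_sum, Finset.mul_sum]
  refine Finset.sum_le_sum fun i _ => ?_
  rw [Finset.mul_sum]
  refine Finset.sum_le_sum fun j _ => (le_abs_self _).trans ?_
  rw [abs_mul, abs_mul, Finset.abs_prod, mul_assoc]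
  refine mul_le_mul_of_nonneg_right ?_ (by positivity)
  calc ∏ l, |G⁻¹ (i l) (j l)| ≤ ∏ _l : Fin k, b :=
        Finset.prod_le_prod (fun _ _ => abs_nonneg _) fun _ _ => hb _ _
    _ = b ^ k := by simp

theorem contDiffOn_det {X : Type*} [NormedAddCommGroup X] [NormedSpace ℝ X] {n : ℕ∞ω}
    {G : X → Matrix (Fin d) (Fin d) ℝ} {Ω : Set X}
    (hG : ∀ i j, ContDiffOn ℝ n (fun y => G y i j) Ω) :
    ContDiffOn ℝ n (fun y => (G y).det) Ω := by
  simp only [Matrix.det_apply]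
  refine ContDiffOn.sum fun σ _ => ContDiffOn.const_smul _ ?_
  exact contDiffOn_prod fun i _ => hG _ _

/-- Cramer's rule: the entries of the inverse are cofactors, polynomial in the entries of the
matrix, divided by the nonvanishing determinant. -/
theorem contDiffOn_inv_apply {X : Type*} [NormedAddCommGroup X] [NormedSpace ℝ X] {n : ℕ∞ω}
    {G : X → Matrix (Fin d) (Fin d) ℝ} {Ω : Set X}
    (hG : ∀ i j, ContDiffOn ℝ n (fun y => G y i j) Ω) (h0 : ∀ y ∈ Ω, (G y).det ≠ 0)
    (i j : Fin d) : ContDiffOn ℝ n (fun y => (G y)⁻¹ i j) Ω := by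
  simp only [Matrix.inv_def, Ring.inverse_eq_inv', Matrix.smul_apply, smul_eq_mul,
    Matrix.adjugate_apply]
  refine ((contDiffOn_det hG).inv h0).mul (contDiffOn_det fun a b => ?_)
  by_cases h : a = j
  · subst h
    simpa using contDiffOn_const
  · simpa [Matrix.updateRow_ne h] using hG a b

theorem continuousAt_tensorNorm {X : Type*} [TopologicalSpace X] {G : X → Matrix (Fin d) (Fin d) ℝ}
    {T : X → (Fin k → Fin d) → ℝ} {x : X} (hG : ∀ i j, ContinuousAt (fun y => (G y)⁻¹ i j) x)
    (hT : ∀ i, ContinuousAt (fun y => T y i) x) :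
    ContinuousAt (fun y => tensorNorm (G y) (T y)) x := by
  unfold tensorNorm
  refine ContinuousAt.sqrt ?_
  refine tendsto_finsetSum _ fun i _ => tendsto_finsetSum _ fun j _ => ?_
  exact ((tendsto_finsetProd _ fun l _ => hG _ _).mul (hT i)).mul (hT j)

end Tensor

/-! ### Invariance under changes of coordinates -/

section ChangeOfCoordinates

variable {d : ℕ}

/-- The Jacobian matrix of `τ`. -/
def jacobian (τ : Euc d → Euc d) (y : Euc d) : Matrix (Fin d) (Fin d) ℝ :=
  Matrix.of fun a i => partialDeriv i (fun z => τ z a) y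

/-- The Christoffel symbols of the metric with matrix `G`. -/
def metricConnection (G : Euc d → Matrix (Fin d) (Fin d) ℝ) : Connection d := fun y a i j =>
  (1 / 2) * ∑ l, (G y)⁻¹ a l *
    (partialDeriv i (fun z => G z j l) y + partialDeriv j (fun z => G z i l) y
      - partialDeriv l (fun z => G z i j) y)

theorem contDiffOn_metricConnection {G : Euc d → Matrix (Fin d) (Fin d) ℝ} {Ω : Set (Euc d)}
    (hΩ : IsOpen Ω) (hG : ∀ i j, ContDiffOn ℝ ∞ (fun y => G y i j) Ω)
    (h0 : ∀ y ∈ Ω, (G y).det ≠ 0) (a i j : Fin d) :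
    ContDiffOn ℝ ∞ (fun y => metricConnection G y a i j) Ω := by
  unfold metricConnection
  refine contDiffOn_const.mul (ContDiffOn.sum fun l _ => (contDiffOn_inv_apply hG h0 a l).mul ?_)
  have h : ∀ a b c, ContDiffOn ℝ ∞ (partialDeriv a (fun z => G z b c)) Ω := fun a b c =>
    contDiffOn_partialDeriv hΩ (hG b c) (by simp) a
  exact ((h _ _ _).add (h _ _ _)).sub (h _ _ _)

theorem contDiffOn_coord {τ : Euc d → Euc d} {Ω : Set (Euc d)} {n : ℕ∞ω}
    (hτ : ContDiffOn ℝ n τ Ω) (b : Fin d) : ContDiffOn ℝ n (fun z => τ z b) Ω :=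
  (EuclideanSpace.proj b : Euc d →L[ℝ] ℝ).contDiff.comp_contDiffOn hτ

theorem contDiffOn_jacobian {τ : Euc d → Euc d} {Ω : Set (Euc d)} (hΩ : IsOpen Ω)
    (hτ : ContDiffOn ℝ ∞ τ Ω) (a i : Fin d) : ContDiffOn ℝ ∞ (fun y => jacobian τ y a i) Ω :=
  contDiffOn_partialDeriv hΩ (contDiffOn_coord hτ a) (by simp) i

theorem partialDeriv_comm {F : Euc d → ℝ} {Ω : Set (Euc d)} (hΩ : IsOpen Ω)
    (hF : ContDiffOn ℝ ∞ F Ω) {y : Euc d} (hy : y ∈ Ω) (i j : Fin d) :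
    partialDeriv i (partialDeriv j F) y = partialDeriv j (partialDeriv i F) y := by
  have hFy := hF.contDiffAt (hΩ.mem_nhds hy)
  have h1 : DifferentiableAt ℝ (fderiv ℝ F) y :=
    (hFy.fderiv_right (m := 1) (ENat.natCast_le_of_coe_top_le_withTop le_rfl 2)).differentiableAt (by simp)
  have h2 : ∀ v w : Euc d, fderiv ℝ (fun z => fderiv ℝ F z v) y w = fderiv ℝ (fderiv ℝ F) y w v := by
    intro v w
    rw [fderiv_clm_apply h1 (differentiableAt_const v)]
    simp
  have h3 := (hFy.isSymmSndFDerivAt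
    (by simpa using ENat.natCast_le_of_coe_top_le_withTop le_rfl 2)).eq
    (EuclideanSpace.single i 1) (EuclideanSpace.single j 1)
  change fderiv ℝ (fun z => fderiv ℝ F z (EuclideanSpace.single j 1)) y _ =
    fderiv ℝ (fun z => fderiv ℝ F z (EuclideanSpace.single i 1)) y _
  rw [h2, h2, h3]

variable {G G' : Euc d → Matrix (Fin d) (Fin d) ℝ} {τ : Euc d → Euc d} {Ω Ω' : Set (Euc d)}

theorem partialDeriv_metric_pullback (hΩ : IsOpen Ω) (hΩ' : IsOpen Ω')
    (hτ : ContDiffOn ℝ ∞ τ Ω) (hm : MapsTo τ Ω Ω')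
    (hG' : ∀ i j, ContDiffOn ℝ ∞ (fun y => G' y i j) Ω')
    (hG : ∀ y ∈ Ω, G y = (jacobian τ y).transpose * G' (τ y) * jacobian τ y)
    {y : Euc d} (hy : y ∈ Ω) (l i j : Fin d) :
    partialDeriv l (fun z => G z i j) y =
      ∑ a, ∑ b, (partialDeriv l (fun z => jacobian τ z a i) y * jacobian τ y b j * G' (τ y) a b +
        jacobian τ y a i * partialDeriv l (fun z => jacobian τ z b j) y * G' (τ y) a b +
        jacobian τ y a i * jacobian τ y b j *
          ∑ c, partialDeriv c (fun z => G' z a b) (τ y) * jacobian τ y c l) := by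
  have hJ : ∀ a i, DifferentiableAt ℝ (fun z => jacobian τ z a i) y := fun a i =>
    ((contDiffOn_jacobian hΩ hτ a i).contDiffAt (hΩ.mem_nhds hy)).differentiableAt (by simp)
  have hτy : DifferentiableAt ℝ τ y := (hτ.contDiffAt (hΩ.mem_nhds hy)).differentiableAt (by simp)
  have hGτ : ∀ a b, DifferentiableAt ℝ (fun z => G' z a b) (τ y) := fun a b =>
    ((hG' a b).contDiffAt (hΩ'.mem_nhds (hm hy))).differentiableAt (by simp)
  have hGc : ∀ a b, DifferentiableAt ℝ (fun z => G' (τ z) a b) y := fun a b => (hGτ a b).comp y hτy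
  rw [partialDeriv_congr (H := fun z => ∑ a, ∑ b, jacobian τ z a i * jacobian τ z b j * G' (τ z) a b)]
  · rw [partialDeriv_sum l fun a _ => DifferentiableAt.fun_sum fun b _ =>
      ((hJ a i).fun_mul (hJ b j)).fun_mul (hGc a b)]
    refine Finset.sum_congr rfl fun a _ => ?_
    rw [partialDeriv_sum l fun b _ => ((hJ a i).fun_mul (hJ b j)).fun_mul (hGc a b)]
    refine Finset.sum_congr rfl fun b _ => ?_
    rw [partialDeriv_mul l ((hJ a i).fun_mul (hJ b j)) (hGc a b), partialDeriv_mul l (hJ a i) (hJ b j),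
      partialDeriv_comp l (hGτ a b) hτy]
    simp only [jacobian, Matrix.of_apply]
    ring
  · filter_upwards [hΩ.mem_nhds hy] with z hz
    rw [hG z hz]
    simp only [Matrix.mul_apply, Matrix.transpose_apply, Finset.sum_mul]
    rw [Finset.sum_comm]
    exact Finset.sum_congr rfl fun a _ => Finset.sum_congr rfl fun b _ => by ring

/-- The transformation law of the Christoffel symbols. -/
theorem metricConnection_pullback (hΩ : IsOpen Ω) (hΩ' : IsOpen Ω')
    (hτ : ContDiffOn ℝ ∞ τ Ω) (hm : MapsTo τ Ω Ω')
    (hG' : ∀ i j, ContDiffOn ℝ ∞ (fun y => G' y i j) Ω')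
    (hsymm : ∀ y i j, G' y i j = G' y j i) (hdet : ∀ y ∈ Ω', IsUnit (G' y).det)
    (hG : ∀ y ∈ Ω, G y = (jacobian τ y).transpose * G' (τ y) * jacobian τ y)
    (hJ : ∀ y ∈ Ω, IsUnit (jacobian τ y).det)
    {y : Euc d} (hy : y ∈ Ω) (c i j : Fin d) :
    ∑ a, jacobian τ y c a * metricConnection G y a i j =
      ∑ a, ∑ b, metricConnection G' (τ y) c a b * jacobian τ y a i * jacobian τ y b j +
        partialDeriv i (fun z => jacobian τ z c j) y := by
  set J := jacobian τ y with hJdef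
  -- `H` collects the second derivatives of `τ`; their symmetry is what lets terms cancel in the
  -- Christoffel combination.
  set H : Fin d → Fin d → Fin d → ℝ := fun a l i => partialDeriv l (fun z => jacobian τ z a i) y
  have hH : ∀ a l i, H a l i = H a i l := fun a l i =>
    partialDeriv_comm hΩ (contDiffOn_coord hτ a) hy l i
  set D : Fin d → Fin d → Fin d → ℝ := fun c a b => partialDeriv c (fun z => G' z a b) (τ y)
  set Q : Fin d → Fin d → Fin d → ℝ := fun l i j => ∑ a, ∑ b, H a l i * J b j * G' (τ y) a b
  have hQ : ∀ l i j, Q l i j = Q i l j := fun l i j => by simp only [Q, hH _ l i]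
  have hD : ∀ l i j, partialDeriv l (fun z => G z i j) y =
      Q l i j + Q l j i + ∑ a, ∑ b, ∑ c, J a i * J b j * J c l * D c a b := by
    intro l i j
    rw [partialDeriv_metric_pullback hΩ hΩ' hτ hm hG' hG hy]
    simp only [Finset.sum_add_distrib, Q]
    congr 1
    · congr 1
      rw [Finset.sum_comm]
      refine Finset.sum_congr rfl fun a _ => Finset.sum_congr rfl fun b _ => ?_
      rw [hsymm (τ y) b a]
      ring
    · refine Finset.sum_congr rfl fun a _ => Finset.sum_congr rfl fun b _ => ?_
      rw [Finset.mul_sum]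
      exact Finset.sum_congr rfl fun c _ => by ring
  -- Of the six second-derivative terms `Q` in this combination, four cancel by the symmetry of `Q`
  -- in its first two indices and two agree, leaving `2 Q i j l`. What remains are first derivatives
  -- of `G'`, in the same Christoffel combination.
  have hlow : ∀ l, partialDeriv i (fun z => G z j l) y + partialDeriv j (fun z => G z i l) y
      - partialDeriv l (fun z => G z i j) y =
      ∑ e, J e l * (2 * (∑ a, H a i j * G' (τ y) a e) +
        ∑ a, ∑ b, J a i * J b j * (D a b e + D b a e - D e a b)) := by
    intro l
    have e1 : ∑ a, ∑ b, ∑ c, J a j * J b l * J c i * D c a b =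
        ∑ e, ∑ a, ∑ b, J e l * (J a i * J b j * D a b e) := by
      rw [Finset.sum_comm]
      refine Finset.sum_congr rfl fun e _ => ?_
      rw [Finset.sum_comm]
      exact Finset.sum_congr rfl fun a _ => Finset.sum_congr rfl fun b _ => by ring
    have e2 : ∑ a, ∑ b, ∑ c, J a i * J b l * J c j * D c a b =
        ∑ e, ∑ a, ∑ b, J e l * (J a i * J b j * D b a e) := by
      rw [Finset.sum_comm]
      exact Finset.sum_congr rfl fun e _ => Finset.sum_congr rfl fun a _ =>
        Finset.sum_congr rfl fun b _ => by ring
    have e3 : ∑ a, ∑ b, ∑ c, J a i * J b j * J c l * D c a b =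
        ∑ e, ∑ a, ∑ b, J e l * (J a i * J b j * D e a b) := by
      rw [Finset.sum_comm' (t' := Finset.univ) (s' := fun _ => Finset.univ) (by simp)]
      rw [Finset.sum_congr rfl fun b _ => Finset.sum_comm, Finset.sum_comm]
      refine Finset.sum_congr rfl fun e _ => ?_
      rw [Finset.sum_comm]
      exact Finset.sum_congr rfl fun a _ => Finset.sum_congr rfl fun b _ => by ring
    have e4 : Q i j l = ∑ e, J e l * ∑ a, H a i j * G' (τ y) a e := by
      simp only [Q, Finset.mul_sum]
      rw [Finset.sum_comm]
      exact Finset.sum_congr rfl fun a _ => Finset.sum_congr rfl fun b _ => by ring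
    rw [hD, hD, hD, e1, e2, e3, hQ l i j, hQ l j i, hQ j i l]
    have e5 : ∑ e, J e l * (2 * (∑ a, H a i j * G' (τ y) a e) +
        ∑ a, ∑ b, J a i * J b j * (D a b e + D b a e - D e a b)) =
        2 * (∑ e, J e l * ∑ a, H a i j * G' (τ y) a e) +
        ((∑ e, ∑ a, ∑ b, J e l * (J a i * J b j * D a b e)) +
        (∑ e, ∑ a, ∑ b, J e l * (J a i * J b j * D b a e)) -
        ∑ e, ∑ a, ∑ b, J e l * (J a i * J b j * D e a b)) := by
      rw [Finset.mul_sum, ← Finset.sum_add_distrib, ← Finset.sum_sub_distrib,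
        ← Finset.sum_add_distrib]
      refine Finset.sum_congr rfl fun e _ => ?_
      simp only [mul_add, mul_sub, Finset.sum_add_distrib, Finset.sum_sub_distrib, Finset.mul_sum]
      congr 1
      exact Finset.sum_congr rfl fun a _ => by ring
    rw [e5, ← e4]
    ring
  -- Raising the index: `J G⁻¹ Jᵀ` is the inverse of `G'` at `τ y`, so the factor `J e l` pulled out
  -- in `hlow` is absorbed.
  have hinv : ∀ e, ∑ a, ∑ l, J c a * (G y)⁻¹ a l * J e l = (G' (τ y))⁻¹ c e := by
    intro e
    have h : J * (G y)⁻¹ * J.transpose = (G' (τ y))⁻¹ := by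
      have hJT : IsUnit J.transpose.det := by rw [Matrix.det_transpose]; exact hJ y hy
      rw [hG y hy, ← hJdef, Matrix.mul_inv_rev, Matrix.mul_inv_rev, ← Matrix.mul_assoc,
        Matrix.mul_nonsing_inv _ (hJ y hy), Matrix.one_mul, Matrix.mul_assoc,
        Matrix.nonsing_inv_mul _ hJT, Matrix.mul_one]
    rw [← h]
    simp only [Matrix.mul_apply, Matrix.transpose_apply, Finset.sum_mul]
    exact Finset.sum_comm
  have hinv' : ∑ e, (G' (τ y))⁻¹ c e * ∑ a, H a i j * G' (τ y) a e = H c i j := by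
    have h : ∀ a, ∑ e, (G' (τ y))⁻¹ c e * G' (τ y) e a = (1 : Matrix (Fin d) (Fin d) ℝ) c a := by
      intro a
      rw [← Matrix.nonsing_inv_mul _ (hdet _ (hm hy)), Matrix.mul_apply]
    calc ∑ e, (G' (τ y))⁻¹ c e * ∑ a, H a i j * G' (τ y) a e
        = ∑ a, (∑ e, (G' (τ y))⁻¹ c e * G' (τ y) e a) * H a i j := by
          simp only [Finset.mul_sum, Finset.sum_mul]
          rw [Finset.sum_comm]
          refine Finset.sum_congr rfl fun a _ => Finset.sum_congr rfl fun e _ => ?_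
          rw [hsymm (τ y) a e]
          ring
      _ = H c i j := by simp [h, Matrix.one_apply]
  calc ∑ a, J c a * metricConnection G y a i j
      = (1 / 2) * ∑ e, (∑ a, ∑ l, J c a * (G y)⁻¹ a l * J e l) *
          (2 * (∑ a, H a i j * G' (τ y) a e) +
            ∑ a, ∑ b, J a i * J b j * (D a b e + D b a e - D e a b)) := by
        simp only [metricConnection, hlow]
        generalize (fun e => 2 * (∑ a, H a i j * G' (τ y) a e) +
            ∑ a, ∑ b, J a i * J b j * (D a b e + D b a e - D e a b)) = w
        simp only [Finset.mul_sum, Finset.sum_mul]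
        rw [Finset.sum_congr rfl fun a _ => Finset.sum_comm, Finset.sum_comm]
        exact Finset.sum_congr rfl fun e _ => Finset.sum_congr rfl fun a _ =>
          Finset.sum_congr rfl fun l _ => by ring
    _ = H c i j + (1 / 2) * ∑ e, (G' (τ y))⁻¹ c e *
          ∑ a, ∑ b, J a i * J b j * (D a b e + D b a e - D e a b) := by
        simp only [hinv, mul_add, Finset.sum_add_distrib]
        congr 1
        rw [← hinv', Finset.mul_sum]
        exact Finset.sum_congr rfl fun e _ => by ring
    _ = _ := by
        rw [add_comm]
        congr 1
        simp only [metricConnection, Finset.mul_sum, Finset.sum_mul]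
        rw [Finset.sum_comm]
        refine Finset.sum_congr rfl fun a _ => ?_
        rw [Finset.sum_comm]
        exact Finset.sum_congr rfl fun b _ => Finset.sum_congr rfl fun e _ => by simp only [D]; ring

/-- Exchanging the `l`-th entry of the multi-index with the extra summation variable is an
involution. It serves to move a replaced index from the Jacobian factors to the tensor components.
-/
theorem sum_update_swap {k : ℕ} (l : Fin k) (f : (Fin k → Fin d) → Fin d → ℝ) :
    ∑ j, ∑ a, f j a = ∑ j, ∑ a, f (Function.update j l a) (j l) := by
  rw [← Fintype.sum_prod_type', ← Fintype.sum_prod_type']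
  refine Fintype.sum_bijective (fun p : (Fin k → Fin d) × Fin d => (Function.update p.1 l p.2, p.1 l))
    (Function.Involutive.bijective fun p => by simp) _ _ fun p => by simp

theorem partialDeriv_prod {k : ℕ} {f : Fin k → Euc d → ℝ} {y : Euc d} (i : Fin d)
    (hf : ∀ l, DifferentiableAt ℝ (f l) y) :
    partialDeriv i (fun z => ∏ l, f l z) y =
      ∑ l, (∏ m ∈ Finset.univ.erase l, f m y) * partialDeriv i (f l) y := by
  have h := HasFDerivAt.finsetProd (u := Finset.univ) fun l _ => (hf l).hasFDerivAt
  simp [partialDeriv, h.fderiv]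

theorem prod_update_right {k : ℕ} (A : Matrix (Fin d) (Fin d) ℝ) (j t : Fin k → Fin d) (l : Fin k)
    (a : Fin d) : ∏ m, A (j m) (Function.update t l a m) =
      (∏ m ∈ Finset.univ.erase l, A (j m) (t m)) * A (j l) a := by
  rw [← Finset.prod_erase_mul _ _ (Finset.mem_univ l)]
  congr 1
  · refine Finset.prod_congr rfl fun m hm => ?_
    rw [Function.update_of_ne (Finset.ne_of_mem_erase hm)]
  · simp

theorem prod_update_left {k : ℕ} (A : Matrix (Fin d) (Fin d) ℝ) (j t : Fin k → Fin d) (l : Fin k)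
    (a : Fin d) : ∏ m, A (Function.update j l a m) (t m) =
      (∏ m ∈ Finset.univ.erase l, A (j m) (t m)) * A a (t l) :=
  prod_update_right A.transpose t j l a

/-- Covariant derivatives transform as tensors when the connections are related by `τ`. -/
theorem genCov_comp_eq_tens {Γ Γ' : Connection d} (hΩ : IsOpen Ω) (hΩ' : IsOpen Ω')
    (hτ : ContDiffOn ℝ ∞ τ Ω) (hm : MapsTo τ Ω Ω')
    (hΓ' : ∀ a i j, ContDiffOn ℝ ∞ (fun y => Γ' y a i j) Ω')
    (hlaw : ∀ y ∈ Ω, ∀ c i j, ∑ a, jacobian τ y c a * Γ y a i j =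
      ∑ a, ∑ b, Γ' (τ y) c a b * jacobian τ y a i * jacobian τ y b j +
        partialDeriv i (fun z => jacobian τ z c j) y)
    {F : Euc d → ℝ} {k : ℕ} (hF : ContDiffOn ℝ k F Ω') {y : Euc d} (hy : y ∈ Ω)
    (i : Fin k → Fin d) :
    genCov Γ (fun z => F (τ z)) k y i = tens (jacobian τ y).transpose (genCov Γ' F k (τ y)) i := by
  induction k generalizing y with
  | zero => simp [genCov, tens]
  | succ k ih =>
    have hF' := hF.of_le (show ((k : ℕ) : ℕ∞ω) ≤ ((k + 1 : ℕ) : ℕ∞ω) by exact_mod_cast Nat.le_succ k)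
    have ih' := fun {z : Euc d} (hz : z ∈ Ω) => ih hF' hz
    clear ih
    have hJd : ∀ a i, DifferentiableAt ℝ (fun z => jacobian τ z a i) y := fun a i =>
      ((contDiffOn_jacobian hΩ hτ a i).contDiffAt (hΩ.mem_nhds hy)).differentiableAt (by simp)
    have hτy : DifferentiableAt ℝ τ y := (hτ.contDiffAt (hΩ.mem_nhds hy)).differentiableAt (by simp)
    have hN : ∀ j : Fin k → Fin d, DifferentiableAt ℝ (fun z => genCov Γ' F k z j) (τ y) := fun j =>
      differentiableAt_genCov hΩ' hΓ' le_rfl hF (hm hy) j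
    have hNc : ∀ j : Fin k → Fin d, DifferentiableAt ℝ (fun z => genCov Γ' F k (τ z) j) y := fun j =>
      (hN j).comp y hτy
    set t := Fin.tail i with ht
    set N := genCov Γ' F k (τ y) with hNdef
    set J := jacobian τ y with hJdef
    have hderiv : partialDeriv (i 0) (fun z => genCov Γ (fun z => F (τ z)) k z t) y =
        ∑ j, ((∑ l, (∏ m ∈ Finset.univ.erase l, J (j m) (t m)) *
          partialDeriv (i 0) (fun z => jacobian τ z (j l) (t l)) y) * N j +
          (∏ l, J (j l) (t l)) * ∑ b, partialDeriv b (fun z => genCov Γ' F k z j) (τ y) * J b (i 0)) := by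
      have hprod : ∀ j : Fin k → Fin d, DifferentiableAt ℝ (fun z => ∏ l, jacobian τ z (j l) (t l)) y :=
        fun j => (HasFDerivAt.finsetProd (u := Finset.univ) fun l _ =>
          (hJd (j l) (t l)).hasFDerivAt).differentiableAt
      rw [partialDeriv_congr (H := fun z => ∑ j, (∏ l, jacobian τ z (j l) (t l)) * genCov Γ' F k (τ z) j) _
        (by filter_upwards [hΩ.mem_nhds hy] with z hz using ih' hz _),
        partialDeriv_sum _ fun j _ => (hprod j).fun_mul (hNc j)]
      refine Finset.sum_congr rfl fun j _ => ?_
      rw [partialDeriv_mul _ (hprod j) (hNc j), partialDeriv_prod _ fun l => hJd _ _,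
        partialDeriv_comp _ (hN j) hτy]
      rfl
    -- The transformation law replaces `JΓ` by `Γ'JJ + ∂J`. The `∂J` part is exactly the
    -- second-derivative sum in `hderiv`, so it disappears in the difference; the rest is the
    -- correction term for `Γ'`.
    have hcorr : ∑ a, ∑ l, Γ y a (i 0) (t l) *
        genCov Γ (fun z => F (τ z)) k y (Function.update t l a) =
        ∑ j, ((∑ l, (∏ m ∈ Finset.univ.erase l, J (j m) (t m)) *
          partialDeriv (i 0) (fun z => jacobian τ z (j l) (t l)) y) * N j) +
        ∑ b, ∑ l, J b (i 0) * ∑ j, ∑ a, Γ' (τ y) (j l) b a *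
          (∏ m, J (Function.update j l a m) (t m)) * N j := by
      have h1 : ∀ a l, Γ y a (i 0) (t l) *
          genCov Γ (fun z => F (τ z)) k y (Function.update t l a) =
          ∑ j, (∏ m ∈ Finset.univ.erase l, J (j m) (t m)) * (J (j l) a * Γ y a (i 0) (t l)) * N j := by
        intro a l
        rw [ih' hy, tens, Finset.mul_sum]
        refine Finset.sum_congr rfl fun j _ => ?_
        simp only [Matrix.transpose_apply]
        rw [prod_update_right]
        ring
      simp only [h1]
      rw [Finset.sum_comm]
      have h2 : ∀ l, ∑ a, ∑ j : Fin k → Fin d, (∏ m ∈ Finset.univ.erase l, J (j m) (t m)) *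
          (J (j l) a * Γ y a (i 0) (t l)) * N j =
          ∑ j : Fin k → Fin d, (∏ m ∈ Finset.univ.erase l, J (j m) (t m)) *
            partialDeriv (i 0) (fun z => jacobian τ z (j l) (t l)) y * N j +
          ∑ b, J b (i 0) * ∑ j, ∑ a, Γ' (τ y) (j l) b a *
            (∏ m, J (Function.update j l a m) (t m)) * N j := by
        intro l
        rw [Finset.sum_comm]
        simp only [Finset.mul_sum]
        rw [Finset.sum_comm (s := (Finset.univ : Finset (Fin d))) (t := (Finset.univ : Finset (Fin k → Fin d))),
          ← Finset.sum_add_distrib]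
        refine Finset.sum_congr rfl fun j _ => ?_
        rw [← Finset.sum_mul, ← Finset.mul_sum, hlaw y hy, mul_add, add_mul, add_comm]
        congr 1
        simp only [Finset.mul_sum, Finset.sum_mul]
        refine Finset.sum_congr rfl fun b _ => Finset.sum_congr rfl fun a _ => ?_
        rw [prod_update_left]
        ring
      simp only [h2, Finset.sum_add_distrib]
      congr 1
      · rw [Finset.sum_comm]
        simp only [Finset.sum_mul]
      · exact Finset.sum_comm
    -- The multi-index of length `k + 1` is split into its first entry `b`, the direction of the
    -- last differentiation, and the remainder `j`.
    have hR : tens J.transpose (genCov Γ' F (k + 1) (τ y)) i =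
        ∑ b, ∑ j, J b (i 0) * (∏ l, J (j l) (t l)) *
          (partialDeriv b (fun z => genCov Γ' F k z j) (τ y) -
            ∑ a, ∑ l, Γ' (τ y) a b (j l) * N (Function.update j l a)) := by
      rw [tens, ← (Fin.consEquiv fun _ => Fin d).sum_comp, Fintype.sum_prod_type]
      refine Finset.sum_congr rfl fun b _ => Finset.sum_congr rfl fun j _ => ?_
      simp [Fin.prod_univ_succ, Fin.consEquiv, genCov, Fin.tail_cons, ht, Fin.tail, hNdef]
    rw [hR]
    change partialDeriv (i 0) (fun z => genCov Γ (fun z => F (τ z)) k z t) y - _ = _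
    rw [hderiv, hcorr, Finset.sum_add_distrib, add_sub_add_left_eq_sub]
    simp only [mul_sub, Finset.sum_sub_distrib]
    congr 1
    · rw [Finset.sum_comm]
      refine Finset.sum_congr rfl fun j _ => ?_
      rw [Finset.mul_sum]
      exact Finset.sum_congr rfl fun b _ => by ring
    · refine Finset.sum_congr rfl fun b _ => ?_
      have h3 : ∀ l, ∑ j, ∑ a, Γ' (τ y) (j l) b a * (∏ m, J (Function.update j l a m) (t m)) * N j =
          ∑ j, ∑ a, Γ' (τ y) a b (j l) * (∏ m, J (j m) (t m)) * N (Function.update j l a) := by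
        intro l
        rw [sum_update_swap l]
        simp
      simp only [h3, Finset.mul_sum]
      rw [Finset.sum_comm]
      refine Finset.sum_congr rfl fun j _ => ?_
      rw [Finset.sum_comm]
      exact Finset.sum_congr rfl fun a _ => Finset.sum_congr rfl fun l _ => by ring

end ChangeOfCoordinates

/-! ### The metric in charts -/

section CoordDomain

variable {d : ℕ} {M : Type*} [TopologicalSpace M] {e e' : OpenPartialHomeomorph M (Euc d)}

/-- The domain in `e`-coordinates of the coordinate expression of a map `Φ` from `V` to the
domain of `e'`. -/
def coordDomain (e e' : OpenPartialHomeomorph M (Euc d)) (Φ : M → M) (V : Set M) : Set (Euc d) :=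
  e.target ∩ e.symm ⁻¹' (V ∩ Φ ⁻¹' e'.source)

variable {Φ : M → M} {V : Set M}

theorem isOpen_coordDomain (hV : IsOpen V) (hΦ : ContinuousOn Φ V) :
    IsOpen (coordDomain e e' Φ V) :=
  e.isOpen_inter_preimage_symm (hΦ.isOpen_inter_preimage hV e'.open_source)

theorem mapsTo_coord_expr :
    MapsTo (fun y => e' (Φ (e.symm y))) (coordDomain e e' Φ V) e'.target :=
  fun _ hy => e'.map_source hy.2.2

end CoordDomain

section Charts

variable {d : ℕ} {M : Type*} [TopologicalSpace M] [ChartedSpace (EuclideanSpace ℝ (Fin d)) M]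
  [IsManifold (𝓡 d) ∞ M] {e e' : OpenPartialHomeomorph M (Euc d)}

theorem bilin_sum_smul (B : Euc d →L[ℝ] Euc d →L[ℝ] ℝ) (α β : Fin d → ℝ) (w : Fin d → Euc d) :
    B (∑ a, α a • w a) (∑ b, β b • w b) = ∑ b, ∑ a, α a * B (w a) (w b) * β b := by
  simp only [map_sum, map_smul, _root_.sum_apply, _root_.smul_apply, smul_eq_mul]
  refine Finset.sum_congr rfl fun b _ => ?_
  rw [Finset.mul_sum]
  exact Finset.sum_congr rfl fun a _ => by ring

theorem natCast_le_infty (n : ℕ) : (n : ℕ∞ω) ≤ (∞ : ℕ∞ω) :=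
  ENat.natCast_le_of_coe_top_le_withTop le_rfl n

theorem contMDiffOn_chart_of_atlas (he : e ∈ atlas (Euc d) M) :
    ContMDiffOn (𝓡 d) (𝓡 d) ∞ e e.source :=
  contMDiffOn_of_mem_maximalAtlas (IsManifold.subset_maximalAtlas he)

theorem contMDiffOn_chart_symm_of_atlas (he : e ∈ atlas (Euc d) M) :
    ContMDiffOn (𝓡 d) (𝓡 d) ∞ e.symm e.target :=
  contMDiffOn_symm_of_mem_maximalAtlas (IsManifold.subset_maximalAtlas he)

/-- A coordinate field is the tangent map of the inverse chart applied to a constant field on the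
coordinate space. -/
theorem contMDiffOn_coordVector (he : e ∈ atlas (Euc d) M) (i : Fin d) :
    ContMDiffOn (𝓡 d) ((𝓡 d).prod (𝓡 d)) ∞
      (fun y => (⟨e.symm y, coordVector e y i⟩ : TangentBundle (𝓡 d) M)) e.target := by
  have h1 := (contMDiffOn_chart_symm_of_atlas he).contMDiffOn_tangentMapWithin (m := ∞)
    (by simp) e.open_target.uniqueMDiffOn
  have h2 : ContMDiffOn (𝓡 d) ((𝓡 d).prod (𝓡 d)) ∞
      (fun y => (⟨y, (EuclideanSpace.single i 1 : Euc d)⟩ : TangentBundle (𝓡 d) (Euc d))) e.target :=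
    contMDiffOn_vectorSpace_iff_contDiffOn.2 contDiffOn_const
  have h3 := h1.comp h2 fun y hy => hy
  refine h3.congr fun y hy => ?_
  have hmd : MDifferentiableAt (𝓡 d) (𝓡 d) e.symm y := mdifferentiableAt_atlas_symm he hy
  exact (tangentMapWithin_eq_tangentMap
    (p := (⟨y, (EuclideanSpace.single i 1 : Euc d)⟩ : TangentBundle (𝓡 d) (Euc d)))
    (e.open_target.uniqueMDiffOn y hy) hmd).symm

variable (g : SmoothMetric d M)

theorem contDiffOn_metricMatrix (he : e ∈ atlas (Euc d) M) (i j : Fin d) :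
    ContDiffOn ℝ ∞ (fun y => metricMatrix g e y i j) e.target := by
  rw [← contMDiffOn_iff_contDiffOn]
  have h := ContMDiffOn.clm_bundle_apply₂ (F₁ := Euc d) (F₂ := Euc d) (F₃ := ℝ)
    (E₃ := Bundle.Trivial M ℝ) (b := e.symm) (ψ := fun y => g.inner (e.symm y))
    (g.contMDiff.comp_contMDiffOn (contMDiffOn_chart_symm_of_atlas he))
    (contMDiffOn_coordVector he i) (contMDiffOn_coordVector he j)
  intro y hy
  have := h y hy
  simp only [Bundle.contMDiffWithinAt_totalSpace] at this
  exact this.2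

theorem metricMatrix_symm (e : OpenPartialHomeomorph M (Euc d)) (y : Euc d) (i j : Fin d) :
    metricMatrix g e y i j = metricMatrix g e y j i :=
  g.symm _ _ _

/-- The quadratic form of the matrix at `v` is `g(Dv, Dv)` with `D` the derivative of the inverse
chart, which is injective. -/
theorem metricMatrix_posDef (he : e ∈ atlas (Euc d) M) {y : Euc d} (hy : y ∈ e.target) :
    (metricMatrix g e y).PosDef := by
  refine Matrix.PosDef.of_dotProduct_mulVec_pos ?_ fun v hv => ?_
  · ext i j
    simpa using metricMatrix_symm g e y j i
  · set D : Euc d →L[ℝ] TangentSpace (𝓡 d) (e.symm y) := mfderiv (𝓡 d) (𝓡 d) e.symm y with hD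
    have h1 : star v ⬝ᵥ (metricMatrix g e y).mulVec v =
        g.inner (e.symm y) (D (WithLp.toLp 2 v)) (D (WithLp.toLp 2 v)) := by
      have h2 : (WithLp.toLp 2 v : Euc d) = ∑ i, v i • (EuclideanSpace.single i (1 : ℝ) : Euc d) := by
        ext a
        simp [Pi.single_apply]
      have h3 : (D (WithLp.toLp 2 v) : Euc d) = ∑ i, v i • (coordVector e y i : Euc d) := by
        have h4 : ∀ D' : Euc d →L[ℝ] Euc d, D' (WithLp.toLp 2 v) =
            ∑ i, v i • D' (EuclideanSpace.single i 1) := by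
          intro D'
          rw [h2, map_sum]
          simp only [map_smul]
        exact h4 D
      refine Eq.trans ?_ (((congrArg₂ (fun u w =>
        (g.inner (e.symm y) : Euc d →L[ℝ] Euc d →L[ℝ] ℝ) u w) h3 h3).trans
          (bilin_sum_smul (g.inner (e.symm y) : Euc d →L[ℝ] Euc d →L[ℝ] ℝ) v v _)).symm)
      simp only [dotProduct, Matrix.mulVec, Finset.mul_sum, star_trivial]
      rw [Finset.sum_comm]
      exact Finset.sum_congr rfl fun b _ => Finset.sum_congr rfl fun a _ => (mul_assoc _ _ _).symm
    rw [h1]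
    refine g.pos _ _ fun h0 => hv ?_
    have hinj : Function.Injective D := by
      have hmd : e.MDifferentiable (𝓡 d) (𝓡 d) := mdifferentiable_of_mem_atlas he
      exact hmd.symm.mfderiv_injective hy
    have := hinj (h0.trans (map_zero D).symm)
    simpa using this

variable {Φ : M → M} {V : Set M}

theorem contDiffOn_coord_expr (he : e ∈ atlas (Euc d) M) (he' : e' ∈ atlas (Euc d) M)
    (hΦ : ContMDiffOn (𝓡 d) (𝓡 d) ∞ Φ V) :
    ContDiffOn ℝ ∞ (fun y => e' (Φ (e.symm y))) (coordDomain e e' Φ V) := by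
  rw [← contMDiffOn_iff_contDiffOn]
  refine (contMDiffOn_chart_of_atlas he').comp ((hΦ.comp ((contMDiffOn_chart_symm_of_atlas he).mono
    inter_subset_left) fun y hy => hy.2.1)) fun y hy => hy.2.2

theorem contDiffOn_chart_symm {n : ℕ∞ω} (hn : n ≤ (∞ : ℕ∞ω)) (he : e ∈ atlas (Euc d) M) {f : M → ℝ}
    (hf : ContMDiff (𝓡 d) 𝓘(ℝ, ℝ) n f) : ContDiffOn ℝ n (fun y => f (e.symm y)) e.target := by
  rw [← contMDiffOn_iff_contDiffOn]
  exact hf.comp_contMDiffOn ((contMDiffOn_chart_symm_of_atlas he).of_le hn)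

/-- Chain rule for `e.symm = e'.symm ∘ τ`: the coordinate vectors of `e` are combinations of those
of `e'` with the columns of the Jacobian as coefficients, and the metric is bilinear. -/
theorem metricMatrix_transition (he : e ∈ atlas (Euc d) M) (he' : e' ∈ atlas (Euc d) M)
    {y : Euc d} (hy : y ∈ coordDomain e e' id univ) :
    metricMatrix g e y = (jacobian (fun z => e' (e.symm z)) y).transpose *
      metricMatrix g e' (e' (e.symm y)) * jacobian (fun z => e' (e.symm z)) y := by
  set τ : Euc d → Euc d := fun z => e' (e.symm z) with hτ
  have hopen : IsOpen (coordDomain e e' id (univ : Set M)) :=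
    isOpen_coordDomain isOpen_univ continuousOn_id
  have hτd : DifferentiableAt ℝ τ y :=
    ((contDiffOn_coord_expr he he' contMDiffOn_id).contDiffAt (hopen.mem_nhds hy)).differentiableAt
      (by simp)
  have hsymm : e'.symm (τ y) = e.symm y := e'.left_inv hy.2.2
  have hcoord : ∀ i, (coordVector e y i : Euc d) = ∑ a, jacobian τ y a i • (coordVector e' (τ y) a : Euc d) := by
    intro i
    have hmd' : MDifferentiableAt (𝓡 d) (𝓡 d) e'.symm (τ y) :=
      mdifferentiableAt_atlas_symm he' (mapsTo_coord_expr hy)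
    have h1 : mfderiv (𝓡 d) (𝓡 d) e.symm y =
        (mfderiv (𝓡 d) (𝓡 d) e'.symm (τ y)).comp (mfderiv (𝓡 d) (𝓡 d) τ y) := by
      rw [← mfderiv_comp y hmd' hτd.mdifferentiableAt]
      refine Filter.EventuallyEq.mfderiv_eq ?_
      filter_upwards [hopen.mem_nhds hy] with z hz
      exact (e'.left_inv hz.2.2).symm
    have h2 : (fderiv ℝ τ y (EuclideanSpace.single i 1) : Euc d) =
        ∑ a, jacobian τ y a i • (EuclideanSpace.single a (1 : ℝ) : Euc d) := by
      ext a
      have : HasFDerivAt (fun z => τ z a)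
        ((EuclideanSpace.proj a : Euc d →L[ℝ] ℝ).comp (fderiv ℝ τ y)) y :=
        (EuclideanSpace.proj a : Euc d →L[ℝ] ℝ).hasFDerivAt.comp y hτd.hasFDerivAt
      simp [jacobian, partialDeriv, this.fderiv, Pi.single_apply]
    set D' : Euc d →L[ℝ] Euc d := mfderiv (𝓡 d) (𝓡 d) e'.symm (τ y)
    have h3 : (coordVector e y i : Euc d) = D' (fderiv ℝ τ y (EuclideanSpace.single i 1)) := by
      rw [coordVector, h1, mfderiv_eq_fderiv]
      rfl
    rw [h3, h2, map_sum D']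
    simp only [map_smul]
    rfl
  ext i j
  have hbase : ∀ {x x' : M} (_ : x = x') (v w : Euc d),
      (g.inner x : Euc d →L[ℝ] Euc d →L[ℝ] ℝ) v w = (g.inner x' : Euc d →L[ℝ] Euc d →L[ℝ] ℝ) v w := by
    rintro x _ rfl v w
    rfl
  have h4 : metricMatrix g e y i j = (g.inner (e'.symm (τ y)) : Euc d →L[ℝ] Euc d →L[ℝ] ℝ)
      (coordVector e y i) (coordVector e y j) := hbase hsymm.symm _ _
  refine h4.trans (((congrArg₂ (fun u w =>
    (g.inner (e'.symm (τ y)) : Euc d →L[ℝ] Euc d →L[ℝ] ℝ) u w) (hcoord i) (hcoord j)).trans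
      (bilin_sum_smul (g.inner (e'.symm (τ y)) : Euc d →L[ℝ] Euc d →L[ℝ] ℝ) _ _ _)).trans ?_)
  simp only [Matrix.mul_apply, Matrix.transpose_apply, Finset.sum_mul]
  rfl

/-- The metric itself shows invertibility: `det G = (det J)² det G'` is positive. -/
theorem isUnit_det_jacobian_transition (g : SmoothMetric d M) (he : e ∈ atlas (Euc d) M) (he' : e' ∈ atlas (Euc d) M)
    {y : Euc d} (hy : y ∈ coordDomain e e' id univ) :
    IsUnit (jacobian (fun z => e' (e.symm z)) y).det := by
  have h := (metricMatrix_posDef g he hy.1).det_pos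
  rw [metricMatrix_transition g he he' hy, Matrix.det_mul] at h
  exact isUnit_iff_ne_zero.2 fun h0 => by simp [h0] at h

theorem covDeriv_eq_genCov (e : OpenPartialHomeomorph M (Euc d)) (f : M → ℝ) (k : ℕ) :
    covDeriv g e f k = genCov (metricConnection (metricMatrix g e)) (fun y => f (e.symm y)) k := by
  induction k with
  | zero => rfl
  | succ k ih =>
    ext y i
    simp only [covDeriv, genCov, ih]
    rfl

theorem contDiffOn_christoffel (he : e ∈ atlas (Euc d) M) (a i j : Fin d) :
    ContDiffOn ℝ ∞ (fun y => metricConnection (metricMatrix g e) y a i j) e.target :=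
  contDiffOn_metricConnection e.open_target (contDiffOn_metricMatrix g he)
    (fun _ hy => (metricMatrix_posDef g he hy).det_pos.ne') a i j

theorem covDeriv_transition (he : e ∈ atlas (Euc d) M) (he' : e' ∈ atlas (Euc d) M)
    {f : M → ℝ} {k : ℕ} (hf : ContMDiff (𝓡 d) 𝓘(ℝ, ℝ) k f)
    {y : Euc d} (hy : y ∈ coordDomain e e' id univ) :
    covDeriv g e f k y = tens (jacobian (fun z => e' (e.symm z)) y).transpose
      (covDeriv g e' f k (e' (e.symm y))) := by
  have hopen : IsOpen (coordDomain e e' id (univ : Set M)) :=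
    isOpen_coordDomain isOpen_univ continuousOn_id
  have hτ : ContDiffOn ℝ ∞ (fun z => e' (e.symm z)) (coordDomain e e' id (univ : Set M)) :=
    contDiffOn_coord_expr he he' contMDiffOn_id
  have hmaps : MapsTo (fun z => e' (e.symm z)) (coordDomain e e' id (univ : Set M)) e'.target :=
    mapsTo_coord_expr
  simp only [covDeriv_eq_genCov]
  ext i
  rw [← genCov_comp_eq_tens hopen e'.open_target hτ hmaps
    (contDiffOn_christoffel g he') ?_
    (contDiffOn_chart_symm (natCast_le_infty _) he' hf) hy i]
  · refine genCov_congr hopen (fun z hz => ?_) k hy i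
    rw [show e'.symm (e' (e.symm z)) = e.symm z from e'.left_inv hz.2.2]
  · intro z hz c i j
    exact metricConnection_pullback hopen e'.open_target hτ hmaps
      (contDiffOn_metricMatrix g he') (metricMatrix_symm g e')
      (fun w hw => isUnit_iff_ne_zero.2 (metricMatrix_posDef g he' hw).det_pos.ne')
      (fun w hw => metricMatrix_transition g he he' hw)
      (fun w hw => isUnit_det_jacobian_transition g he he' hw) hz c i j

/-- `|∇^k f|` can be computed in any chart of the atlas. -/
theorem covNorm_eq (he : e ∈ atlas (Euc d) M) {f : M → ℝ} {k : ℕ}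
    (hf : ContMDiff (𝓡 d) 𝓘(ℝ, ℝ) k f) {x : M} (hx : x ∈ e.source) :
    covNorm g f k x = tensorNorm (metricMatrix g e (e x)) (covDeriv g e f k (e x)) := by
  set e₀ := chartAt (Euc d) x
  have he₀ : e₀ ∈ atlas (Euc d) M := chart_mem_atlas _ x
  have hx₀ : x ∈ e₀.source := mem_chart_source _ x
  have hy : e₀ x ∈ coordDomain e₀ e id (univ : Set M) :=
    ⟨e₀.map_source hx₀, mem_univ _, by simpa [e₀.left_inv hx₀] using hx⟩
  have hpull := tensorNorm_pullback (k := k) (metricMatrix_posDef g he (mapsTo_coord_expr hy))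
    (isUnit_det_jacobian_transition g he₀ he hy) (covDeriv g e f k (e (e₀.symm (e₀ x))))
  simp only [id] at hpull
  rw [← covDeriv_transition g he₀ he hf hy, ← metricMatrix_transition g he₀ he hy,
    e₀.left_inv hx₀] at hpull
  exact hpull

theorem covNorm_nonneg (f : M → ℝ) (k : ℕ) (x : M) : 0 ≤ covNorm g f k x := Real.sqrt_nonneg _

theorem continuousAt_inv_metricMatrix (he : e ∈ atlas (Euc d) M) {y : Euc d} (hy : y ∈ e.target)
    (i j : Fin d) : ContinuousAt (fun z => (metricMatrix g e z)⁻¹ i j) y :=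
  (contDiffOn_inv_apply (contDiffOn_metricMatrix g he)
    (fun _ hz => (metricMatrix_posDef g he hz).det_pos.ne') i j).continuousOn.continuousAt
    (e.open_target.mem_nhds hy)

/-- The preferred chart may change from point to point, so continuity is checked in one fixed chart
near `x`, where `covNorm_eq` allows the norm to be computed. -/
theorem continuous_covNorm {f : M → ℝ} {k : ℕ} (hf : ContMDiff (𝓡 d) 𝓘(ℝ, ℝ) k f) :
    Continuous (covNorm g f k) := by
  refine continuous_iff_continuousAt.2 fun x => ?_
  set e := chartAt (Euc d) x
  have he : e ∈ atlas (Euc d) M := chart_mem_atlas _ x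
  have hx : x ∈ e.source := mem_chart_source _ x
  have hT : ∀ i, ContinuousAt (fun y => covDeriv g e f k y i) (e x) := by
    intro i
    rw [covDeriv_eq_genCov]
    have := contDiffOn_genCov e.open_target (contDiffOn_christoffel g he) k 0
      (by simpa using contDiffOn_chart_symm (natCast_le_infty _) he hf) i
    exact this.continuousOn.continuousAt (e.open_target.mem_nhds (e.map_source hx))
  have h : ContinuousAt (fun y => tensorNorm (metricMatrix g e y) (covDeriv g e f k y)) (e x) :=
    continuousAt_tensorNorm (continuousAt_inv_metricMatrix g he (e.map_source hx)) hT
  refine (ContinuousAt.comp (f := e) h (e.continuousAt hx)).congr ?_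
  filter_upwards [e.open_source.mem_nhds hx] with z hz
  exact (covNorm_eq g he hf hz).symm

theorem covNorm_add_le {f h : M → ℝ} {k : ℕ} (hf : ContMDiff (𝓡 d) 𝓘(ℝ, ℝ) k f)
    (hh : ContMDiff (𝓡 d) 𝓘(ℝ, ℝ) k h) (x : M) :
    covNorm g (f + h) k x ≤ covNorm g f k x + covNorm g h k x := by
  set e := chartAt (Euc d) x with he_def
  have he : e ∈ atlas (Euc d) M := chart_mem_atlas _ x
  have hx := e.map_source (mem_chart_source (Euc d) x)
  have hadd : covDeriv g e (f + h) k (e x) = covDeriv g e f k (e x) + covDeriv g e h k (e x) := by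
    ext i
    simp only [covDeriv_eq_genCov, Pi.add_apply]
    exact genCov_add e.open_target (contDiffOn_christoffel g he)
      (contDiffOn_chart_symm (natCast_le_infty _) he hf)
      (contDiffOn_chart_symm (natCast_le_infty _) he hh) hx i
  have := tensorNorm_add_le (metricMatrix_posDef g he hx) (covDeriv g e f k (e x))
    (covDeriv g e h k (e x))
  rwa [← hadd] at this

theorem covNorm_smul {f : M → ℝ} {k : ℕ} (c : ℝ) (hf : ContMDiff (𝓡 d) 𝓘(ℝ, ℝ) k f) (x : M) :
    covNorm g (c • f) k x = |c| * covNorm g f k x := by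
  set e := chartAt (Euc d) x with he_def
  have he : e ∈ atlas (Euc d) M := chart_mem_atlas _ x
  have hx := e.map_source (mem_chart_source (Euc d) x)
  have hsmul : covDeriv g e (c • f) k (e x) = c • covDeriv g e f k (e x) := by
    ext i
    simp only [covDeriv_eq_genCov, Pi.smul_apply, smul_eq_mul]
    exact genCov_const_mul e.open_target (contDiffOn_christoffel g he) c
      (contDiffOn_chart_symm (natCast_le_infty _) he hf) hx i
  have := tensorNorm_smul (metricMatrix g e (e x)) c (covDeriv g e f k (e x))
  rwa [← hsmul] at this

theorem covNorm_zero_order (f : M → ℝ) (x : M) : covNorm g f 0 x = |f x| := by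
  have hx : (chartAt (Euc d) x).symm (chartAt (Euc d) x x) = x :=
    (chartAt (Euc d) x).left_inv (mem_chart_source _ x)
  simp [covNorm, covDeriv, hx, Real.sqrt_mul_self_eq_abs]

theorem covNorm_congr {f h : M → ℝ} {x : M} (hfh : f =ᶠ[𝓝 x] h) (k : ℕ) :
    covNorm g f k x = covNorm g h k x := by
  set e := chartAt (Euc d) x
  have hx : x ∈ e.source := mem_chart_source _ x
  obtain ⟨s, hs, hso, hxs⟩ := eventually_nhds_iff.1 hfh
  have : covDeriv g e f k (e x) = covDeriv g e h k (e x) := by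
    ext i
    simp only [covDeriv_eq_genCov]
    refine genCov_congr (e.isOpen_inter_preimage_symm hso) (fun z hz => hs _ hz.2) k ?_ i
    exact ⟨e.map_source hx, by simpa [e.left_inv hx] using hxs⟩
  change tensorNorm _ (covDeriv g e f k (e x)) = tensorNorm _ (covDeriv g e h k (e x))
  rw [this]

theorem covNorm_zero_fun (k : ℕ) (x : M) : covNorm g (0 : M → ℝ) k x = 0 := by
  have h := covNorm_smul g (k := k) (0 : ℝ) (f := (0 : M → ℝ)) contMDiff_const x
  simpa using h

end Charts

/-! ### The Riemannian measure -/

section Measure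

theorem det_jacobian_eq {d : ℕ} {τ : Euc d → Euc d} {y : Euc d} (hτ : DifferentiableAt ℝ τ y) :
    (fderiv ℝ τ y).det = (jacobian τ y).det := by
  rw [ContinuousLinearMap.det, ← LinearMap.det_toMatrix (EuclideanSpace.basisFun (Fin d) ℝ).toBasis]
  congr 1
  ext a i
  have : HasFDerivAt (fun z => τ z a)
      ((EuclideanSpace.proj a : Euc d →L[ℝ] ℝ).comp (fderiv ℝ τ y)) y :=
    (EuclideanSpace.proj a : Euc d →L[ℝ] ℝ).hasFDerivAt.comp y hτ.hasFDerivAt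
  simp [LinearMap.toMatrix_apply, jacobian, partialDeriv, this.fderiv]

/-- Inverse charts and local diffeomorphisms are controlled only on their domains; measurability is
obtained on the subtype and transported by the inclusion of a measurable set. -/
theorem measurableSet_inter_preimage_of_continuousOn {X Y : Type*} [TopologicalSpace X]
    [MeasurableSpace X] [BorelSpace X] [TopologicalSpace Y] [MeasurableSpace Y] [BorelSpace Y]
    {f : X → Y} {V : Set X} (hf : ContinuousOn f V) (hV : MeasurableSet V) {A : Set Y}
    (hA : MeasurableSet A) : MeasurableSet (V ∩ f ⁻¹' A) := by
  have h := (continuousOn_iff_continuous_domRestrict.1 hf).measurable hA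
  have h2 := hV.subtype_image h
  have h3 : Subtype.val '' (V.domRestrict f ⁻¹' A) = V ∩ f ⁻¹' A := by
    ext x
    simp [and_comm]
  rwa [h3] at h2

variable {d : ℕ} {M : Type*} [TopologicalSpace M] [ChartedSpace (EuclideanSpace ℝ (Fin d)) M]
  [IsManifold (𝓡 d) ∞ M] {e e' : OpenPartialHomeomorph M (Euc d)} (g : SmoothMetric d M)

theorem contDiffOn_det_metricMatrix (he : e ∈ atlas (Euc d) M) :
    ContDiffOn ℝ ∞ (fun y => (metricMatrix g e y).det) e.target :=
  contDiffOn_det (contDiffOn_metricMatrix g he)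

theorem continuousAt_sqrt_det (he : e ∈ atlas (Euc d) M) {y : Euc d} (hy : y ∈ e.target) :
    ContinuousAt (fun y => √(metricMatrix g e y).det) y :=
  ((contDiffOn_det_metricMatrix g he).continuousOn.continuousAt (e.open_target.mem_nhds hy)).sqrt

theorem sqrt_det_transition (he : e ∈ atlas (Euc d) M) (he' : e' ∈ atlas (Euc d) M)
    {y : Euc d} (hy : y ∈ coordDomain e e' id univ) :
    √(metricMatrix g e y).det = |(jacobian (fun z => e' (e.symm z)) y).det| *
      √(metricMatrix g e' (e' (e.symm y))).det := by
  rw [metricMatrix_transition g he he' hy, Matrix.det_mul, Matrix.det_mul, Matrix.det_transpose,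
    ← Real.sqrt_sq_eq_abs, ← Real.sqrt_mul (sq_nonneg _)]
  congr 1
  ring

/-- A diffeomorphism between open sets has invertible derivative in coordinates. -/
theorem det_jacobian_ne_zero (he : e ∈ atlas (Euc d) M) (he' : e' ∈ atlas (Euc d) M)
    (Φ : OpenPartialHomeomorph M M) (hΦ : ContMDiffOn (𝓡 d) (𝓡 d) ∞ Φ Φ.source)
    (hΦ' : ContMDiffOn (𝓡 d) (𝓡 d) ∞ Φ.symm Φ.target)
    {y : Euc d} (hy : y ∈ coordDomain e e' Φ Φ.source) :
    (jacobian (fun z => e' (Φ (e.symm z))) y).det ≠ 0 := by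
  set Ψ : Euc d → Euc d := fun z => e' (Φ (e.symm z)) with hΨ
  set Ψ' : Euc d → Euc d := fun z => e (Φ.symm (e'.symm z)) with hΨ'
  have hopen := isOpen_coordDomain (e := e) (e' := e') Φ.open_source Φ.continuousOn
  have hopen' := isOpen_coordDomain (e := e') (e' := e) Φ.open_target Φ.continuousOn_symm
  have hinv : ∀ z ∈ coordDomain e e' Φ Φ.source, Ψ' (Ψ z) = z := by
    intro z hz
    simp only [hΨ, hΨ']
    rw [e'.left_inv hz.2.2, Φ.left_inv hz.2.1, e.right_inv hz.1]
  have hy' : Ψ y ∈ coordDomain e' e Φ.symm Φ.target := by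
    refine ⟨e'.map_source hy.2.2, ?_⟩
    have h1 : e'.symm (Ψ y) = Φ (e.symm y) := e'.left_inv hy.2.2
    rw [mem_preimage, h1]
    refine ⟨Φ.map_source hy.2.1, ?_⟩
    rw [mem_preimage, Φ.left_inv hy.2.1]
    exact e.map_target hy.1
  have hd : DifferentiableAt ℝ Ψ y :=
    ((contDiffOn_coord_expr he he' hΦ).contDiffAt (hopen.mem_nhds hy)).differentiableAt (by simp)
  have hd' : DifferentiableAt ℝ Ψ' (Ψ y) :=
    ((contDiffOn_coord_expr he' he hΦ').contDiffAt (hopen'.mem_nhds hy')).differentiableAt (by simp)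
  have hcomp : (fderiv ℝ Ψ' (Ψ y)).comp (fderiv ℝ Ψ y) = ContinuousLinearMap.id ℝ (Euc d) := by
    rw [← fderiv_comp y hd' hd, ← fderiv_id (𝕜 := ℝ) (x := y)]
    refine Filter.EventuallyEq.fderiv_eq ?_
    filter_upwards [hopen.mem_nhds hy] with z hz using hinv z hz
  rw [← det_jacobian_eq hd]
  intro h0
  have h1 := congrArg ContinuousLinearMap.det hcomp
  have h2 : ((fderiv ℝ Ψ' (Ψ y)).comp (fderiv ℝ Ψ y)).det =
      (fderiv ℝ Ψ' (Ψ y)).det * (fderiv ℝ Ψ y).det := by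
    simp only [ContinuousLinearMap.det]
    exact LinearMap.det_comp _ _
  rw [h2, h0, mul_zero] at h1
  simp [ContinuousLinearMap.det] at h1

variable [MeasurableSpace M]

theorem chartMeasure_le_riemannianMeasure (he : e ∈ atlas (Euc d) M) :
    chartMeasure g e ≤ riemannianMeasure g :=
  le_iSup₂ (f := fun e (_ : e ∈ atlas (Euc d) M) => chartMeasure g e) e he

variable [BorelSpace M]

theorem chartMeasure_apply (e : OpenPartialHomeomorph M (Euc d)) {A : Set M}
    (hA : MeasurableSet A) :
    chartMeasure g e A =
      ∫⁻ y in e.target ∩ e.symm ⁻¹' A, ENNReal.ofReal √(metricMatrix g e y).det := by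
  have h1 : AEMeasurable e.symm ((volume.restrict e.target).withDensity
      fun y => ENNReal.ofReal √(metricMatrix g e y).det) :=
    (e.continuousOn_symm.aemeasurable e.open_target.measurableSet).mono_ac
      (withDensity_absolutelyContinuous _ _)
  rw [chartMeasure, Measure.map_apply_of_aemeasurable h1 hA, withDensity_apply' _ _,
    Measure.restrict_restrict' e.open_target.measurableSet, inter_comm]

/-- Change of variables along the coordinate expression of `Φ`, given a pointwise comparison of
densities. With `Φ = id` and `c = 1` it compares two charts; with a diffeomorphism and a locally
chosen `c` it bounds the distortion of volume. -/
theorem chartMeasure_inter_preimage_le (he : e ∈ atlas (Euc d) M) (he' : e' ∈ atlas (Euc d) M)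
    {Φ : M → M} {V N A : Set M} (hV : IsOpen V) (hΦ : ContMDiffOn (𝓡 d) (𝓡 d) ∞ Φ V)
    (hinj : InjOn Φ V) (hN : MeasurableSet N) (hNV : N ⊆ V ∩ Φ ⁻¹' e'.source)
    (hA : MeasurableSet A) (c : ℝ≥0)
    (hc : ∀ x ∈ N, x ∈ e.source → √(metricMatrix g e (e x)).det ≤
      c * (|(jacobian (fun z => e' (Φ (e.symm z))) (e x)).det| *
        √(metricMatrix g e' (e' (Φ x))).det)) :
    chartMeasure g e (N ∩ Φ ⁻¹' A) ≤ c * chartMeasure g e' A := by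
  have hNA : MeasurableSet (N ∩ Φ ⁻¹' A) := by
    have h := measurableSet_inter_preimage_of_continuousOn hΦ.continuousOn hV.measurableSet hA
    have h2 : N ∩ Φ ⁻¹' A = N ∩ (V ∩ Φ ⁻¹' A) := by
      ext x
      constructor
      · rintro ⟨h1, h2⟩
        exact ⟨h1, (hNV h1).1, h2⟩
      · rintro ⟨h1, -, h2⟩
        exact ⟨h1, h2⟩
    rw [h2]
    exact hN.inter h
  rw [chartMeasure_apply g e hNA, chartMeasure_apply g e' hA]
  set Ψ : Euc d → Euc d := fun z => e' (Φ (e.symm z)) with hΨ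
  set S := e.target ∩ e.symm ⁻¹' (N ∩ Φ ⁻¹' A) with hS
  have hSm : MeasurableSet S := measurableSet_inter_preimage_of_continuousOn e.continuousOn_symm
    e.open_target.measurableSet hNA
  have hSΩ : S ⊆ coordDomain e e' Φ V := fun y hy => ⟨hy.1, hNV hy.2.1⟩
  have hopen := isOpen_coordDomain (e := e) (e' := e') hV hΦ.continuousOn
  have hd : ∀ y ∈ S, DifferentiableAt ℝ Ψ y := fun y hy =>
    ((contDiffOn_coord_expr he he' hΦ).contDiffAt (hopen.mem_nhds (hSΩ hy))).differentiableAt (by simp)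
  have hΨinj : InjOn Ψ S := by
    intro y hy z hz hyz
    have h1 := e'.injOn (hNV hy.2.1).2 (hNV hz.2.1).2 hyz
    exact e.symm.injOn hy.1 hz.1 (hinj (hNV hy.2.1).1 (hNV hz.2.1).1 h1)
  have hcov := lintegral_image_eq_lintegral_abs_det_fderiv_mul volume hSm
    (fun y hy => (hd y hy).hasFDerivAt.hasFDerivWithinAt) hΨinj
    (fun z => ENNReal.ofReal √(metricMatrix g e' z).det)
  have himg : Ψ '' S ⊆ e'.target ∩ e'.symm ⁻¹' A := by
    rintro _ ⟨y, hy, rfl⟩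
    refine ⟨e'.map_source (hNV hy.2.1).2, ?_⟩
    simp only [hΨ, mem_preimage]
    rw [e'.left_inv (hNV hy.2.1).2]
    exact hy.2.2
  calc ∫⁻ y in S, ENNReal.ofReal √(metricMatrix g e y).det
      ≤ ∫⁻ y in S, c * (ENNReal.ofReal |(fderiv ℝ Ψ y).det| *
          ENNReal.ofReal √(metricMatrix g e' (Ψ y)).det) := by
        refine setLIntegral_mono' hSm fun y hy => ?_
        rw [det_jacobian_eq (hd y hy), ← ENNReal.ofReal_mul (abs_nonneg _),
          ← ENNReal.ofReal_coe_nnreal, ← ENNReal.ofReal_mul c.coe_nonneg]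
        refine ENNReal.ofReal_le_ofReal ?_
        have h := hc (e.symm y) hy.2.1 (e.map_target hy.1)
        rwa [e.right_inv hy.1] at h
    _ = c * ∫⁻ z in Ψ '' S, ENNReal.ofReal √(metricMatrix g e' z).det := by
        rw [hcov, lintegral_const_mul' _ _ ENNReal.coe_ne_top]
    _ ≤ _ := by gcongr

theorem chartMeasure_inter_source_le (he : e ∈ atlas (Euc d) M) (he' : e' ∈ atlas (Euc d) M)
    {A : Set M} (hA : MeasurableSet A) :
    chartMeasure g e (A ∩ e'.source) ≤ chartMeasure g e' A := by
  have h := chartMeasure_inter_preimage_le g he he' (Φ := id) (N := e'.source) (A := A) isOpen_univ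
    contMDiffOn_id (injOn_id _) e'.open_source.measurableSet (by simp) hA 1 (fun x hx hxe => by
      have h := sqrt_det_transition g he he' (y := e x)
        ⟨e.map_source hxe, mem_univ _, by simpa [e.left_inv hxe] using hx⟩
      rw [e.left_inv hxe] at h
      simp only [NNReal.coe_one, one_mul, id]
      exact h.le)
  simpa [inter_comm] using h

/-- A supremum of measures is not computed set by set, so it is bounded by a dominating measure: the
chart measure of `e` plus the restriction of the Riemannian measure to the complement of the domain
of `e` dominates every chart measure. The second summand vanishes on subsets of that domain. -/
theorem riemannianMeasure_le_chartMeasure (he : e ∈ atlas (Euc d) M) {A : Set M}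
    (hA : MeasurableSet A) (hAe : A ⊆ e.source) :
    riemannianMeasure g A ≤ chartMeasure g e A := by
  have h : riemannianMeasure g ≤ chartMeasure g e + (riemannianMeasure g).restrict e.sourceᶜ := by
    refine iSup₂_le fun e' he' => Measure.le_iff.2 fun B hB => ?_
    rw [← measure_inter_add_sdiff B e.open_source.measurableSet, Measure.add_apply,
      Measure.restrict_apply hB]
    exact add_le_add (chartMeasure_inter_source_le g he' he hB)
      (chartMeasure_le_riemannianMeasure g he' _)
  refine (h A).trans ?_
  rw [Measure.add_apply, Measure.restrict_apply hA,
    (disjoint_compl_right_iff_subset.2 hAe).inter_eq, measure_empty, add_zero]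

/-- Near `x` the density is bounded and the coordinates stay in a unit ball. On compact `M` the
measure is then finite, which places `C(M)` in `L^p`. -/
instance isLocallyFiniteMeasure_riemannianMeasure :
    IsLocallyFiniteMeasure (riemannianMeasure g) := by
  refine ⟨fun x => ?_⟩
  set e := chartAt (Euc d) x
  have he : e ∈ atlas (Euc d) M := chart_mem_atlas _ x
  have hx : x ∈ e.source := mem_chart_source _ x
  set b := √(metricMatrix g e (e x)).det + 1
  have hev : ∀ᶠ y in 𝓝 (e x), √(metricMatrix g e y).det < b ∧ y ∈ Metric.ball (e x) 1 :=
    ((continuousAt_sqrt_det g he (e.map_source hx)).eventually_lt continuousAt_const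
      (lt_add_one _)).and (Metric.ball_mem_nhds _ one_pos)
  obtain ⟨O, hO, hOo, hxO⟩ := eventually_nhds_iff.1 hev
  have hN : IsOpen (e.source ∩ e ⁻¹' O) := e.isOpen_inter_preimage hOo
  refine ⟨e.source ∩ e ⁻¹' O, hN.mem_nhds ⟨hx, hxO⟩, ?_⟩
  have hsub : e.target ∩ e.symm ⁻¹' (e.source ∩ e ⁻¹' O) ⊆ O := by
    rintro y ⟨hy, -, hy2⟩
    simpa [e.right_inv hy] using hy2
  calc riemannianMeasure g (e.source ∩ e ⁻¹' O)
      ≤ chartMeasure g e (e.source ∩ e ⁻¹' O) :=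
        riemannianMeasure_le_chartMeasure g he hN.measurableSet inter_subset_left
    _ ≤ ∫⁻ y in O, ENNReal.ofReal √(metricMatrix g e y).det := by
        rw [chartMeasure_apply g e hN.measurableSet]
        exact lintegral_mono_set hsub
    _ ≤ ∫⁻ y in O, ENNReal.ofReal b :=
        setLIntegral_mono' hOo.measurableSet fun y hy => ENNReal.ofReal_le_ofReal (hO y hy).1.le
    _ = ENNReal.ofReal b * volume O := by simp
    _ < ⊤ := ENNReal.mul_lt_top ENNReal.ofReal_lt_top
        ((measure_mono fun y hy => (hO y hy).2).trans_lt measure_ball_lt_top)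

/-- The density is bounded below by a positive number near each point. This is what makes a
continuous function determined by its class in `L^p`. -/
instance isOpenPosMeasure_riemannianMeasure :
    (riemannianMeasure g).IsOpenPosMeasure := by
  refine ⟨fun U hU ⟨x, hxU⟩ => ?_⟩
  set e := chartAt (Euc d) x
  have he : e ∈ atlas (Euc d) M := chart_mem_atlas _ x
  have hx : x ∈ e.source := mem_chart_source _ x
  have hpos : 0 < √(metricMatrix g e (e x)).det :=
    Real.sqrt_pos.2 (metricMatrix_posDef g he (e.map_source hx)).det_pos
  obtain ⟨b, hb0, hb⟩ := exists_between hpos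
  have hev : ∀ᶠ y in 𝓝 (e x), b < √(metricMatrix g e y).det ∧ y ∈ e.target ∩ e.symm ⁻¹' U :=
    (continuousAt_const.eventually_lt (continuousAt_sqrt_det g he (e.map_source hx)) hb).and
      ((e.isOpen_inter_preimage_symm hU).mem_nhds
        ⟨e.map_source hx, by simpa [e.left_inv hx] using hxU⟩)
  obtain ⟨O, hO, hOo, hxO⟩ := eventually_nhds_iff.1 hev
  have h1 : ENNReal.ofReal b * volume O ≤ riemannianMeasure g U := by
    calc ENNReal.ofReal b * volume O = ∫⁻ y in O, ENNReal.ofReal b := by simp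
      _ ≤ ∫⁻ y in O, ENNReal.ofReal √(metricMatrix g e y).det :=
          setLIntegral_mono' hOo.measurableSet fun y hy => ENNReal.ofReal_le_ofReal (hO y hy).1.le
      _ ≤ chartMeasure g e U := by
          rw [chartMeasure_apply g e hU.measurableSet]
          exact lintegral_mono_set fun y hy => (hO y hy).2
      _ ≤ riemannianMeasure g U := chartMeasure_le_riemannianMeasure g he U
  exact ((ENNReal.mul_pos (ENNReal.ofReal_pos.2 hb0).ne' (hOo.measure_pos volume ⟨_, hxO⟩).ne').trans_le
    h1).ne'

theorem exists_measure_inter_preimage_le (Φ : OpenPartialHomeomorph M M)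
    (hΦ : ContMDiffOn (𝓡 d) (𝓡 d) ∞ Φ Φ.source)
    (hΦ' : ContMDiffOn (𝓡 d) (𝓡 d) ∞ Φ.symm Φ.target) {K : Set M} (hK : IsCompact K)
    (hKs : K ⊆ Φ.source) :
    ∃ c : ℝ≥0, ∀ A, MeasurableSet A →
      riemannianMeasure g (K ∩ Φ ⁻¹' A) ≤ c * riemannianMeasure g A := by
  refine hK.induction_on (p := fun s => ∃ c : ℝ≥0, ∀ A, MeasurableSet A →
      riemannianMeasure g (s ∩ Φ ⁻¹' A) ≤ c * riemannianMeasure g A) ⟨0, by simp⟩ ?_ ?_ ?_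
  · rintro s t hst ⟨c, hc⟩
    exact ⟨c, fun A hA => (measure_mono (inter_subset_inter_left _ hst)).trans (hc A hA)⟩
  · rintro s t ⟨c, hc⟩ ⟨c', hc'⟩
    refine ⟨c + c', fun A hA => ?_⟩
    rw [union_inter_distrib_right, ENNReal.coe_add, add_mul]
    exact (measure_union_le _ _).trans (add_le_add (hc A hA) (hc' A hA))
  · intro x hxK
    set e := chartAt (Euc d) x
    set e' := chartAt (Euc d) (Φ x)
    have he : e ∈ atlas (Euc d) M := chart_mem_atlas _ x
    have he' : e' ∈ atlas (Euc d) M := chart_mem_atlas _ (Φ x)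
    have hx : x ∈ e.source := mem_chart_source _ x
    have hΦx : Φ x ∈ e'.source := mem_chart_source _ (Φ x)
    set Ψ : Euc d → Euc d := fun z => e' (Φ (e.symm z)) with hΨ
    have hopen := isOpen_coordDomain (e := e) (e' := e') Φ.open_source Φ.continuousOn
    have hΨc := contDiffOn_coord_expr he he' hΦ
    have hy : e x ∈ coordDomain e e' Φ Φ.source := by
      refine ⟨e.map_source hx, ?_⟩
      rw [mem_preimage, e.left_inv hx]
      exact ⟨hKs hxK, hΦx⟩
    -- `D` is the density, in the chart at `x`, of the volume pulled back by `Φ`. Any number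
    -- exceeding the ratio of the two densities at `x` still exceeds it nearby, and serves as the
    -- local constant.
    set D : Euc d → ℝ := fun y => |(jacobian Ψ y).det| * √(metricMatrix g e' (Ψ y)).det
    have hD0 : 0 < D (e x) := mul_pos
      (abs_pos.2 (det_jacobian_ne_zero he he' Φ hΦ hΦ' hy))
      (Real.sqrt_pos.2 (metricMatrix_posDef g he' (mapsTo_coord_expr hy)).det_pos)
    have hDc : ContinuousAt D (e x) := by
      refine ContinuousAt.mul ?_ ?_
      · exact ((contDiffOn_det (contDiffOn_jacobian hopen hΨc)).continuousOn.continuousAt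
          (hopen.mem_nhds hy)).abs
      · exact ContinuousAt.comp (f := Ψ) (continuousAt_sqrt_det g he' (mapsTo_coord_expr hy))
          (hΨc.continuousOn.continuousAt (hopen.mem_nhds hy))
    obtain ⟨c, hc⟩ := exists_nat_gt (√(metricMatrix g e (e x)).det / D (e x))
    rw [div_lt_iff₀ hD0] at hc
    have hev : ∀ᶠ y in 𝓝 (e x), √(metricMatrix g e y).det < c * D y ∧
        y ∈ coordDomain e e' Φ Φ.source :=
      ((continuousAt_sqrt_det g he (e.map_source hx)).eventually_lt (continuousAt_const.mul hDc)
        hc).and (hopen.mem_nhds hy)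
    obtain ⟨O, hO, hOo, hxO⟩ := eventually_nhds_iff.1 hev
    have hN : IsOpen (e.source ∩ e ⁻¹' O) := e.isOpen_inter_preimage hOo
    refine ⟨e.source ∩ e ⁻¹' O, mem_nhdsWithin_of_mem_nhds (hN.mem_nhds ⟨hx, hxO⟩), c,
      fun A hA => ?_⟩
    have hNsub : e.source ∩ e ⁻¹' O ⊆ Φ.source ∩ Φ ⁻¹' e'.source := by
      rintro z ⟨hz, hzO⟩
      have := (hO _ hzO).2.2
      rwa [mem_preimage, e.left_inv hz] at this
    have hm : MeasurableSet (e.source ∩ e ⁻¹' O ∩ Φ ⁻¹' A) := by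
      have h := measurableSet_inter_preimage_of_continuousOn
        (Φ.continuousOn.mono (hNsub.trans inter_subset_left)) hN.measurableSet hA
      exact h
    calc riemannianMeasure g (e.source ∩ e ⁻¹' O ∩ Φ ⁻¹' A)
        ≤ chartMeasure g e (e.source ∩ e ⁻¹' O ∩ Φ ⁻¹' A) :=
          riemannianMeasure_le_chartMeasure g he hm fun z hz => hz.1.1
      _ ≤ (c : ℝ≥0) * chartMeasure g e' A :=
          chartMeasure_inter_preimage_le g he he' Φ.open_source hΦ Φ.injOn hN.measurableSet hNsub
            hA c fun z hz _ => by
              have h := (hO _ hz.2).1.le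
              simp only [D, hΨ] at h
              rw [e.left_inv hz.1] at h
              simpa using h
      _ ≤ _ := by
          push_cast
          gcongr
          exact chartMeasure_le_riemannianMeasure g he'

/-- Composition with a diffeomorphism is bounded in `L^p` over compact subsets of its domain. -/
theorem exists_eLpNorm_comp_le [T2Space M] (Φ : OpenPartialHomeomorph M M)
    (hΦ : ContMDiffOn (𝓡 d) (𝓡 d) ∞ Φ Φ.source)
    (hΦ' : ContMDiffOn (𝓡 d) (𝓡 d) ∞ Φ.symm Φ.target) {K : Set M} (hK : IsCompact K)
    (hKs : K ⊆ Φ.source) {p : ℝ≥0∞} (hp : p ≠ ⊤) :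
    ∃ c : ℝ≥0, ∀ h : M → ℝ, Continuous h →
      eLpNorm (fun x => h (Φ x)) p ((riemannianMeasure g).restrict K) ≤
        c * eLpNorm h p (riemannianMeasure g) := by
  obtain ⟨c, hc⟩ := exists_measure_inter_preimage_le g Φ hΦ hΦ' hK hKs
  have hae : AEMeasurable Φ ((riemannianMeasure g).restrict K) :=
    (Φ.continuousOn.mono hKs).aemeasurable hK.measurableSet
  -- The push-forward of the measure on `K` is dominated by a multiple of the whole measure; passing
  -- to `L^p` norms turns the factor `c` into `c^{1/p}`.
  have hle : Measure.map Φ ((riemannianMeasure g).restrict K) ≤ c • riemannianMeasure g := by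
    refine Measure.le_iff.2 fun A hA => ?_
    rw [Measure.map_apply_of_aemeasurable hae hA, Measure.restrict_apply' hK.measurableSet,
      inter_comm]
    exact hc A hA
  refine ⟨c ^ (1 / p).toReal, fun h hh => ?_⟩
  have h1 := eLpNorm_map_measure (p := p) (g := h)
    (μ := (riemannianMeasure g).restrict K) (f := Φ)
    hh.measurable.aestronglyMeasurable hae
  calc eLpNorm (fun x => h (Φ x)) p ((riemannianMeasure g).restrict K)
      = eLpNorm h p (Measure.map Φ ((riemannianMeasure g).restrict K)) := h1.symm
    _ ≤ eLpNorm h p ((c : ℝ≥0∞) • riemannianMeasure g) := eLpNorm_mono_measure _ hle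
    _ = _ := by
        rw [eLpNorm_smul_measure_of_ne_top hp, smul_eq_mul,
          ENNReal.coe_rpow_of_nonneg _ ENNReal.toReal_nonneg]

end Measure

/-! ### Estimates for `H`-operators -/

section HOperators

variable {d : ℕ} {M : Type*} [TopologicalSpace M] [ChartedSpace (EuclideanSpace ℝ (Fin d)) M]

theorem SimpleH.op_eventuallyEq_zero (H : SimpleH d M) (f : M → ℝ) {x : M}
    (hx : x ∉ tsupport H.φ) : H.op f =ᶠ[𝓝 x] 0 := by
  filter_upwards [(isClosed_tsupport H.φ).isOpen_compl.mem_nhds hx] with z hz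
  simp [SimpleH.op, image_eq_zero_of_notMem_tsupport hz]

theorem SimpleH.op_of_mem (H : SimpleH d M) (f : M → ℝ) {x : M} (hx : x ∈ H.Φ.source) :
    H.op f x = H.φ x * f (H.Φ x) := by
  simp [SimpleH.op, hx]

/-- Extension by zero keeps smoothness because the closed support of `φ` lies inside the domain of
`Φ`: every point is either in that open domain or has a neighbourhood where the result vanishes. -/
theorem SimpleH.contMDiff_op (H : SimpleH d M) {n : ℕ∞ω} (hn : n ≤ (∞ : ℕ∞ω)) {f : M → ℝ}
    (hf : ContMDiff (𝓡 d) 𝓘(ℝ, ℝ) n f) : ContMDiff (𝓡 d) 𝓘(ℝ, ℝ) n (H.op f) := by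
  intro x
  by_cases hx : x ∈ tsupport H.φ
  · have hs := H.Φ.open_source.mem_nhds (H.tsupport_φ hx)
    have h1 : ContMDiffAt (𝓡 d) 𝓘(ℝ, ℝ) n (fun z => f (H.Φ z)) x :=
      hf.contMDiffAt.comp x ((H.smooth_Φ.contMDiffAt hs).of_le hn)
    refine (((H.smooth_φ x).of_le hn).mul h1).congr_of_eventuallyEq ?_
    filter_upwards [hs] with z hz using H.op_of_mem f hz
  · exact (contMDiffAt_const (c := (0 : ℝ))).congr_of_eventuallyEq (H.op_eventuallyEq_zero f hx)

variable [IsManifold (𝓡 d) ∞ M] (g : SmoothMetric d M)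

/-- The coefficients of the combination depend on `φ`, `Φ` and the metric only, so one constant and
one neighbourhood serve all `f`. Continuity at `x₀` bounds everything. -/
theorem SimpleH.exists_eventually_covNorm_op_le (H : SimpleH d M) (k : ℕ) {x₀ : M}
    (hx₀ : x₀ ∈ H.Φ.source) :
    ∃ C : ℝ≥0, ∀ᶠ x in 𝓝 x₀, ∀ f : M → ℝ, ContMDiff (𝓡 d) 𝓘(ℝ, ℝ) k f →
      covNorm g (H.op f) k x ≤ C * ∑ m ∈ Finset.range (k + 1), covNorm g f m (H.Φ x) := by
  set Φ := H.Φ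
  set e := chartAt (Euc d) x₀
  set e' := chartAt (Euc d) (Φ x₀)
  have he : e ∈ atlas (Euc d) M := chart_mem_atlas _ x₀
  have he' : e' ∈ atlas (Euc d) M := chart_mem_atlas _ (Φ x₀)
  have hx : x₀ ∈ e.source := mem_chart_source _ x₀
  set Ψ : Euc d → Euc d := fun z => e' (Φ (e.symm z)) with hΨ
  set Ω := coordDomain e e' Φ Φ.source
  have hopen : IsOpen Ω := isOpen_coordDomain Φ.open_source Φ.continuousOn
  have hΨc : ContDiffOn ℝ ∞ Ψ Ω := contDiffOn_coord_expr he he' H.smooth_Φ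
  have hmaps : MapsTo Ψ Ω e'.target := mapsTo_coord_expr
  have hy : e x₀ ∈ Ω := by
    refine ⟨e.map_source hx, ?_⟩
    rw [mem_preimage, e.left_inv hx]
    exact ⟨hx₀, mem_chart_source _ (Φ x₀)⟩
  have ha : ContDiffOn ℝ ∞ (fun y => H.φ (e.symm y)) Ω :=
    (contDiffOn_chart_symm le_rfl he H.smooth_φ).mono inter_subset_left
  choose c hc hcomb using fun i : Fin k → Fin d =>
    isComb_genCov_mul_comp (Γ := metricConnection (metricMatrix g e'))
      (Γ₁ := metricConnection (metricMatrix g e)) hopen e'.open_target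
      (fun a b j => (contDiffOn_christoffel g he a b j).mono inter_subset_left)
      (contDiffOn_christoffel g he') hΨc hmaps ha k i
  -- The square root is the product of lengths of the coordinate vectors at `Ψ y`, the price for
  -- bounding a component of `∇^m f` by its norm. `R` controls the passage back, from components of
  -- the result to its norm; adding 1 to the values at `x₀` leaves room for continuity.
  set Q : Euc d → ℝ := fun y => ∑ i : Fin k → Fin d, ∑ m ∈ Finset.range (k + 1),
    ∑ j : Fin m → Fin d, |c i m j y| * √(∏ l, metricMatrix g e' (Ψ y) (j l) (j l))
  set R : Euc d → ℝ := fun y => ∑ i, ∑ j, |(metricMatrix g e y)⁻¹ i j|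
  have hQ : ContinuousAt Q (e x₀) := by
    refine tendsto_finsetSum _ fun i _ => tendsto_finsetSum _ fun m _ =>
      tendsto_finsetSum _ fun j _ => ContinuousAt.mul ?_ ?_
    · exact ((hc i m j).continuousOn.continuousAt (hopen.mem_nhds hy)).abs
    · refine ContinuousAt.sqrt (tendsto_finsetProd _ fun l _ => ?_)
      exact ContinuousAt.comp (f := Ψ) (g := fun z => metricMatrix g e' z (j l) (j l))
        ((contDiffOn_metricMatrix g he' _ _).continuousOn.continuousAt
          (e'.open_target.mem_nhds (hmaps hy))) (hΨc.continuousOn.continuousAt (hopen.mem_nhds hy))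
  have hR : ContinuousAt R (e x₀) :=
    tendsto_finsetSum _ fun i _ => tendsto_finsetSum _ fun j _ =>
      (continuousAt_inv_metricMatrix g he (e.map_source hx) i j).abs
  set b := R (e x₀) + 1
  set q := Q (e x₀) + 1
  have hev : ∀ᶠ y in 𝓝 (e x₀), Q y < q ∧ R y < b ∧ y ∈ Ω :=
    (hQ.eventually_lt continuousAt_const (lt_add_one _)).and
      ((hR.eventually_lt continuousAt_const (lt_add_one _)).and (hopen.mem_nhds hy))
  refine ⟨(√(b ^ k) * q).toNNReal, ?_⟩
  filter_upwards [(e.continuousAt hx).eventually hev, e.open_source.mem_nhds hx] with x hex hxs f hf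
  obtain ⟨hQx, hRx, hxΩ⟩ := hex
  set y := e x with hydef
  have hxsymm : e.symm y = x := e.left_inv hxs
  have hxV : x ∈ Φ.source := by have := hxΩ.2.1; rwa [hxsymm] at this
  have hxe' : Φ x ∈ e'.source := by have := hxΩ.2.2; rwa [mem_preimage, hxsymm] at this
  have hΨy : Ψ y = e' (Φ x) := by simp only [hΨ, hxsymm]
  set S := ∑ m ∈ Finset.range (k + 1), covNorm g f m (Φ x) with hS
  have hop : ContMDiff (𝓡 d) 𝓘(ℝ, ℝ) k (H.op f) := H.contMDiff_op (natCast_le_infty k) hf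
  have hcov : ∀ i : Fin k → Fin d, |covDeriv g e (H.op f) k y i| ≤
      (∑ m ∈ Finset.range (k + 1), ∑ j : Fin m → Fin d,
        |c i m j y| * √(∏ l, metricMatrix g e' (Ψ y) (j l) (j l))) * S := by
    intro i
    have h1 : covDeriv g e (H.op f) k y i = ∑ m ∈ Finset.range (k + 1), ∑ j,
        c i m j y * covDeriv g e' f m (Ψ y) j := by
      simp only [covDeriv_eq_genCov]
      rw [← hcomb i _ (contDiffOn_chart_symm (natCast_le_infty k) he' hf) y hxΩ]
      refine genCov_congr hopen (fun z hz => ?_) k hxΩ i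
      rw [H.op_of_mem f hz.2.1]
      simp only [hΨ]
      rw [e'.left_inv hz.2.2]
    rw [h1, Finset.sum_mul]
    refine (Finset.abs_sum_le_sum_abs _ _).trans (Finset.sum_le_sum fun m hm => ?_)
    rw [Finset.sum_mul]
    refine (Finset.abs_sum_le_sum_abs _ _).trans (Finset.sum_le_sum fun j _ => ?_)
    rw [abs_mul, mul_assoc]
    refine mul_le_mul_of_nonneg_left ?_ (abs_nonneg _)
    have hfm : ContMDiff (𝓡 d) 𝓘(ℝ, ℝ) m f :=
      hf.of_le (by exact_mod_cast Nat.lt_succ_iff.1 (Finset.mem_range.1 hm))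
    have hpd := metricMatrix_posDef g he' (hmaps hxΩ)
    have h2 := sq_le_prod_mul_tensorNorm_sq hpd (covDeriv g e' f m (Ψ y)) j
    have h3 : tensorNorm (metricMatrix g e' (Ψ y)) (covDeriv g e' f m (Ψ y)) = covNorm g f m (Φ x) := by
      rw [covNorm_eq g he' hfm hxe', hΨy]
    rw [h3] at h2
    calc |covDeriv g e' f m (Ψ y) j|
        ≤ √((∏ l, metricMatrix g e' (Ψ y) (j l) (j l)) * covNorm g f m (Φ x) ^ 2) :=
          Real.abs_le_sqrt h2
      _ = √(∏ l, metricMatrix g e' (Ψ y) (j l) (j l)) * covNorm g f m (Φ x) := by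
          rw [Real.sqrt_mul (Finset.prod_nonneg fun l _ => hpd.diag_pos.le),
            Real.sqrt_sq (covNorm_nonneg g f m _)]
      _ ≤ _ := mul_le_mul_of_nonneg_left (Finset.single_le_sum
          (f := fun m => covNorm g f m (Φ x)) (fun m _ => covNorm_nonneg g f m _) hm)
          (Real.sqrt_nonneg _)
  have hS0 : 0 ≤ S := Finset.sum_nonneg fun m _ => covNorm_nonneg g f m _
  calc covNorm g (H.op f) k x
      = tensorNorm (metricMatrix g e y) (covDeriv g e (H.op f) k y) := covNorm_eq g he hop hxs
    _ ≤ √(b ^ k) * ∑ i, |covDeriv g e (H.op f) k y i| := by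
        refine tensorNorm_le_of_inv_le (fun i j => le_trans ?_ hRx.le) _
        exact (Finset.single_le_sum (f := fun j => |(metricMatrix g e y)⁻¹ i j|)
          (fun j _ => abs_nonneg _) (Finset.mem_univ j)).trans
          (Finset.single_le_sum (f := fun i => ∑ j, |(metricMatrix g e y)⁻¹ i j|)
            (fun i _ => Finset.sum_nonneg fun j _ => abs_nonneg _) (Finset.mem_univ i))
    _ ≤ √(b ^ k) * (Q y * S) := by
        refine mul_le_mul_of_nonneg_left ?_ (Real.sqrt_nonneg _)
        rw [Finset.sum_mul]
        exact Finset.sum_le_sum fun i _ => hcov i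
    _ ≤ √(b ^ k) * (q * S) := by gcongr
    _ = √(b ^ k) * q * S := by ring
    _ ≤ _ := mul_le_mul_of_nonneg_right (Real.le_coe_toNNReal _) hS0

theorem SimpleH.covNorm_op_eq_zero (H : SimpleH d M) (k : ℕ) (f : M → ℝ) {x : M}
    (hx : x ∉ tsupport H.φ) : covNorm g (H.op f) k x = 0 := by
  rw [covNorm_congr g (H.op_eventuallyEq_zero f hx), covNorm_zero_fun]

theorem SimpleH.exists_covNorm_op_le (H : SimpleH d M) (k : ℕ) :
    ∃ C : ℝ≥0, ∀ f : M → ℝ, ContMDiff (𝓡 d) 𝓘(ℝ, ℝ) k f → ∀ x ∈ tsupport H.φ,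
      covNorm g (H.op f) k x ≤ C * ∑ m ∈ Finset.range (k + 1), covNorm g f m (H.Φ x) := by
  have hK : IsCompact (tsupport H.φ) := H.compact_φ
  -- With `x` quantified before `f`, the statement becomes a property of the set of points that is
  -- stable under subsets and finite unions, so compactness reduces it to neighbourhoods of points.
  suffices h : ∃ C : ℝ≥0, ∀ x ∈ tsupport H.φ, ∀ f : M → ℝ, ContMDiff (𝓡 d) 𝓘(ℝ, ℝ) k f →
      covNorm g (H.op f) k x ≤ C * ∑ m ∈ Finset.range (k + 1), covNorm g f m (H.Φ x) by
    obtain ⟨C, hC⟩ := h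
    exact ⟨C, fun f hf x hx => hC x hx f hf⟩
  refine hK.induction_on (p := fun s => ∃ C : ℝ≥0, ∀ x ∈ s, ∀ f : M → ℝ,
    ContMDiff (𝓡 d) 𝓘(ℝ, ℝ) k f →
      covNorm g (H.op f) k x ≤ C * ∑ m ∈ Finset.range (k + 1), covNorm g f m (H.Φ x)) ⟨0, by simp⟩
    ?_ ?_ ?_
  · rintro s t hst ⟨C, hC⟩
    exact ⟨C, fun x hx => hC x (hst hx)⟩
  · rintro s t ⟨C, hC⟩ ⟨C', hC'⟩
    have hmono : ∀ {c : ℝ≥0} {f : M → ℝ} {x : M}, c ≤ max C C' →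
        (c : ℝ) * ∑ m ∈ Finset.range (k + 1), covNorm g f m (H.Φ x) ≤
        (max C C' : ℝ≥0) * ∑ m ∈ Finset.range (k + 1), covNorm g f m (H.Φ x) := fun h =>
      mul_le_mul_of_nonneg_right (by exact_mod_cast h)
        (Finset.sum_nonneg fun m _ => covNorm_nonneg g _ m _)
    refine ⟨max C C', fun x hx f hf => ?_⟩
    rcases hx with hx | hx
    · exact (hC x hx f hf).trans (hmono (le_max_left _ _))
    · exact (hC' x hx f hf).trans (hmono (le_max_right _ _))
  · intro x hx
    obtain ⟨C, hC⟩ := H.exists_eventually_covNorm_op_le g k (H.tsupport_φ hx)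
    exact ⟨_, mem_nhdsWithin_of_mem_nhds hC, C, fun z hz => hz⟩

theorem SimpleH.exists_iSup_covNorm_op_le (H : SimpleH d M) (k : ℕ) :
    ∃ c : ℝ≥0, ∀ f : M → ℝ, ContMDiff (𝓡 d) 𝓘(ℝ, ℝ) k f →
      ⨆ x, ENNReal.ofReal (covNorm g (H.op f) k x) ≤
        c * ∑ m ∈ Finset.range (k + 1), ⨆ x, ENNReal.ofReal (covNorm g f m x) := by
  obtain ⟨C, hC⟩ := H.exists_covNorm_op_le g k
  refine ⟨C, fun f hf => iSup_le fun x => ?_⟩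
  by_cases hx : x ∈ tsupport H.φ
  · refine (ENNReal.ofReal_le_ofReal (hC f hf x hx)).trans ?_
    rw [ENNReal.ofReal_mul C.coe_nonneg, ENNReal.ofReal_coe_nnreal,
      ENNReal.ofReal_sum_of_nonneg fun m _ => covNorm_nonneg g f m _]
    gcongr with m _
    exact le_iSup (fun x => ENNReal.ofReal (covNorm g f m x)) (H.Φ x)
  · simp [H.covNorm_op_eq_zero g k f hx]

theorem SimpleH.exists_eLpNorm_covNorm_op_le [T2Space M] [MeasurableSpace M] [BorelSpace M]
    (H : SimpleH d M) {p : ℝ≥0∞} (hp1 : 1 ≤ p) (hp : p ≠ ⊤) (k : ℕ) :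
    ∃ c : ℝ≥0, ∀ f : M → ℝ, ContMDiff (𝓡 d) 𝓘(ℝ, ℝ) k f →
      eLpNorm (covNorm g (H.op f) k) p (riemannianMeasure g) ≤
        c * ∑ m ∈ Finset.range (k + 1), eLpNorm (covNorm g f m) p (riemannianMeasure g) := by
  obtain ⟨C, hC⟩ := H.exists_covNorm_op_le g k
  have hK : IsCompact (tsupport H.φ) := H.compact_φ
  obtain ⟨c, hc⟩ := exists_eLpNorm_comp_le g H.Φ H.smooth_Φ H.smooth_Φ_symm hK H.tsupport_φ hp
  refine ⟨C * c, fun f hf => ?_⟩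
  set K := tsupport H.φ with hKdef
  have hcont : ∀ m ∈ Finset.range (k + 1), Continuous (covNorm g f m) := fun m hm =>
    continuous_covNorm g (hf.of_le (by exact_mod_cast Nat.lt_succ_iff.1 (Finset.mem_range.1 hm)))
  -- Off the support of `φ` the covariant derivatives vanish, so the integral reduces to `K`, where
  -- both the pointwise bound and the bounded distortion of volume hold.
  have hind : covNorm g (H.op f) k = K.indicator (covNorm g (H.op f) k) := by
    ext x
    by_cases hx : x ∈ K
    · simp [hx]
    · rw [indicator_of_notMem hx, H.covNorm_op_eq_zero g k f hx]
  have hmeas : ∀ m ∈ Finset.range (k + 1), AEStronglyMeasurable (fun x => covNorm g f m (H.Φ x))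
      ((riemannianMeasure g).restrict K) := fun m hm =>
    ((hcont m hm).measurable.comp_aemeasurable
      ((H.Φ.continuousOn.mono H.tsupport_φ).aemeasurable hK.measurableSet)).aestronglyMeasurable
  calc eLpNorm (covNorm g (H.op f) k) p (riemannianMeasure g)
      = eLpNorm (covNorm g (H.op f) k) p ((riemannianMeasure g).restrict K) := by
        conv_lhs => rw [hind]
        exact eLpNorm_indicator_eq_eLpNorm_restrict hK.measurableSet
    _ ≤ C * eLpNorm (∑ m ∈ Finset.range (k + 1), fun x => covNorm g f m (H.Φ x)) p
          ((riemannianMeasure g).restrict K) := by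
        refine eLpNorm_le_nnreal_smul_eLpNorm_of_ae_le_mul ?_ p
        filter_upwards [ae_restrict_mem hK.measurableSet] with x hx
        rw [← NNReal.coe_le_coe]
        simp only [coe_nnnorm, NNReal.coe_mul, Finset.sum_apply]
        rw [Real.norm_of_nonneg (covNorm_nonneg g _ k x),
          Real.norm_of_nonneg (Finset.sum_nonneg fun m _ => covNorm_nonneg g f m _)]
        exact hC f hf x hx
    _ ≤ C * ∑ m ∈ Finset.range (k + 1), eLpNorm (fun x => covNorm g f m (H.Φ x)) p
          ((riemannianMeasure g).restrict K) := by
        gcongr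
        exact eLpNorm_sum_le hmeas hp1
    _ ≤ C * ∑ m ∈ Finset.range (k + 1), c * eLpNorm (covNorm g f m) p (riemannianMeasure g) := by
        gcongr with m hm
        exact hc _ (hcont m hm)
    _ = _ := by
        rw [← Finset.mul_sum, ENNReal.coe_mul, mul_assoc]

omit [IsManifold (𝓡 d) ∞ M] in
theorem IsLocalizedHOperator.contMDiff {U : Set M} {T : C(M, ℝ) →ₗ[ℝ] C(M, ℝ)}
    (hT : IsLocalizedHOperator d U T) {n : ℕ∞ω} (hn : n ≤ (∞ : ℕ∞ω)) {f : C(M, ℝ)}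
    (hf : ContMDiff (𝓡 d) 𝓘(ℝ, ℝ) n f) : ContMDiff (𝓡 d) 𝓘(ℝ, ℝ) n (T f) := by
  obtain ⟨m, H, -, h⟩ := hT
  have : ⇑(T f) = fun x => ∑ i, (H i).op f x := funext (h f)
  rw [this]
  exact contMDiff_finsetSum fun i _ => (H i).contMDiff_op hn hf

omit [IsManifold (𝓡 d) ∞ M] in
/-- Bounds for simple `H`-operators, in the sum of seminorms of orders at most `r`, carry over to
finite combinations. -/
theorem IsLocalizedHOperator.exists_sum_le {U : Set M} {T : C(M, ℝ) →ₗ[ℝ] C(M, ℝ)}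
    (hT : IsLocalizedHOperator d U T) (r : ℕ) (N : ℕ → (M → ℝ) → ℝ≥0∞)
    (hzero : ∀ k, N k 0 = 0)
    (hadd : ∀ (k : ℕ) (f h : M → ℝ), ContMDiff (𝓡 d) 𝓘(ℝ, ℝ) k f → ContMDiff (𝓡 d) 𝓘(ℝ, ℝ) k h →
      N k (f + h) ≤ N k f + N k h)
    (hop : ∀ (k : ℕ) (H : SimpleH d M), ∃ c : ℝ≥0, ∀ f : M → ℝ, ContMDiff (𝓡 d) 𝓘(ℝ, ℝ) k f →
      N k (H.op f) ≤ c * ∑ m ∈ Finset.range (k + 1), N m f) :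
    ∃ c : ℝ≥0, ∀ f : C(M, ℝ), ContMDiff (𝓡 d) 𝓘(ℝ, ℝ) r f →
      ∑ k ∈ Finset.range (r + 1), N k (T f) ≤ c * ∑ k ∈ Finset.range (r + 1), N k f := by
  obtain ⟨n, H, -, h⟩ := hT
  choose c hc using hop
  -- Each order `k ≤ r` and each summand is estimated by the full sum up to `r`, so the constants
  -- add up over both.
  refine ⟨∑ k ∈ Finset.range (r + 1), ∑ i, c k (H i), fun f hf => ?_⟩
  rw [ENNReal.ofNNReal_finsetSum, Finset.sum_mul]
  refine Finset.sum_le_sum fun k hk => ?_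
  have hfk : ContMDiff (𝓡 d) 𝓘(ℝ, ℝ) k f :=
    hf.of_le (by exact_mod_cast Nat.lt_succ_iff.1 (Finset.mem_range.1 hk))
  have hTf : ⇑(T f) = ∑ i, (H i).op f := by
    ext x
    simp [h f x]
  have hsum : ∀ s : Finset (Fin n), ContMDiff (𝓡 d) 𝓘(ℝ, ℝ) k (∑ i ∈ s, (H i).op f) ∧
      N k (∑ i ∈ s, (H i).op f) ≤ ∑ i ∈ s, N k ((H i).op f) := by
    classical
    intro s
    induction s using Finset.induction_on with
    | empty => exact ⟨contMDiff_const, by simp [hzero]⟩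
    | insert i s hi ih =>
      have hi' := (H i).contMDiff_op (natCast_le_infty k) hfk
      rw [Finset.sum_insert hi, Finset.sum_insert hi]
      exact ⟨hi'.add ih.1, (hadd k _ _ hi' ih.1).trans (add_le_add le_rfl ih.2)⟩
  rw [hTf, ENNReal.ofNNReal_finsetSum, Finset.sum_mul]
  refine (hsum Finset.univ).2.trans (Finset.sum_le_sum fun i _ => (hc k (H i) f hfk).trans ?_)
  gcongr
  exact Nat.lt_succ_iff.1 (Finset.mem_range.1 hk)

end HOperators

/-! ### Direct sums and equivalent norms -/

section DirectSum

variable {X : Type*} [AddCommGroup X] [Module ℝ X] {ι : Type*} [Fintype ι]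

/-- Independence: `P_i` fixes its own image and kills the others, so an element common to its image
and the span of the others is both preserved and annihilated. -/
theorem isDirectSumOfImages_of_forall (S : Submodule ℝ X) {P : ι → X →ₗ[ℝ] X}
    (hmap : ∀ i, ∀ f ∈ S, P i f ∈ S) (hproj : ∀ i f, P i (P i f) = P i f)
    (horth : ∀ i j, i ≠ j → ∀ f, P i (P j f) = 0) (hsum : ∀ f, ∑ i, P i f = f) :
    IsDirectSumOfImages (S : Set X) P := by
  have hle : ∀ i, S.map (P i) ≤ S := by
    rintro i _ ⟨f, hf, rfl⟩
    exact hmap i f hf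
  refine ⟨S, rfl, hle, ?_, le_antisymm (iSup_le hle) fun f hf => ?_, fun f _ => hsum f⟩
  · intro i
    rw [Submodule.disjoint_def]
    rintro _ ⟨f, -, rfl⟩ hf
    have hker : (⨆ j, ⨆ (_ : j ≠ i), S.map (P j)) ≤ LinearMap.ker (P i) := by
      refine iSup₂_le fun j hj => ?_
      rintro _ ⟨h, -, rfl⟩
      exact horth i j hj.symm h
    have h0 : P i (P i f) = 0 := hker hf
    rwa [hproj] at h0
  · rw [← hsum f]
    exact Submodule.sum_mem _ fun i _ =>
      Submodule.mem_iSup_of_mem i (Submodule.mem_map_of_mem hf)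

theorem hasEquivalentNorms_of_forall (S : Submodule ℝ X) {N : X → ℝ≥0∞} {P : ι → X →ₗ[ℝ] X}
    (hfin : ∀ f ∈ S, N f < ⊤) (hzero : N 0 = 0)
    (hadd : ∀ f ∈ S, ∀ h ∈ S, N (f + h) ≤ N f + N h) (hmap : ∀ i, ∀ f ∈ S, P i f ∈ S)
    (hbdd : ∀ i, ∃ c : ℝ≥0, ∀ f ∈ S, N (P i f) ≤ c * N f) (hsum : ∀ f, ∑ i, P i f = f) :
    HasEquivalentNorms (S : Set X) N P := by
  classical
  choose c hc using hbdd
  -- The summand 1 serves the triangle inequality and keeps the constant positive; the sum of the `c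
  -- i` serves the converse estimate.
  refine ⟨hfin, 1 + ∑ i, c i, by positivity, fun f hf => ⟨?_, ?_⟩⟩
  · have h : ∀ s : Finset ι, N (∑ i ∈ s, P i f) ≤ ∑ i ∈ s, N (P i f) := by
      intro s
      induction s using Finset.induction_on with
      | empty => simp [hzero]
      | insert i s hi ih =>
        rw [Finset.sum_insert hi, Finset.sum_insert hi]
        exact (hadd _ (hmap i f hf) _ (S.sum_mem fun j _ => hmap j f hf)).trans
          (add_le_add le_rfl ih)
    calc N f = N (∑ i, P i f) := by rw [hsum]
      _ ≤ 1 * ∑ i, N (P i f) := by rw [one_mul]; exact h _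
      _ ≤ _ := by gcongr; simp
  · calc ∑ i, N (P i f) ≤ ∑ i, c i * N f := Finset.sum_le_sum fun i _ => hc i f hf
      _ = ((∑ i, c i : ℝ≥0) : ℝ≥0∞) * N f := by
          rw [ENNReal.ofNNReal_finsetSum, Finset.sum_mul]
      _ ≤ _ := by gcongr; simp

end DirectSum

/-- Past the larger of two thresholds both tails are controlled. It yields the triangle inequality
for the norm of the completion, which is defined by upper limits. -/
theorem ennreal_limsup_add_le (u v : ℕ → ℝ≥0∞) :
    limsup (fun n => u n + v n) atTop ≤ limsup u atTop + limsup v atTop := by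
  rw [limsup_eq_iInf_iSup_of_nat (u := u), limsup_eq_iInf_iSup_of_nat (u := v),
    limsup_eq_iInf_iSup_of_nat]
  refine ENNReal.le_iInf_add_iInf fun n m => (iInf_le _ (max n m)).trans ?_
  refine iSup₂_le fun i hi => add_le_add ?_ ?_
  · exact le_iSup₂ (f := fun i (_ : i ≥ n) => u i) i ((le_max_left n m).trans hi)
  · exact le_iSup₂ (f := fun i (_ : i ≥ m) => v i) i ((le_max_right n m).trans hi)

theorem contMDiff_const_smul {d : ℕ} {M : Type*} [TopologicalSpace M]
    [ChartedSpace (EuclideanSpace ℝ (Fin d)) M] {n : ℕ∞ω} (c : ℝ) {f : M → ℝ}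
    (hf : ContMDiff (𝓡 d) 𝓘(ℝ, ℝ) n f) : ContMDiff (𝓡 d) 𝓘(ℝ, ℝ) n (c • f) :=
  ContMDiff.smul (contMDiff_const (c := c) : ContMDiff (𝓡 d) 𝓘(ℝ, ℝ) n fun _ : M => c) hf

/-! ### Homogeneity, triangle inequality and boundedness for the norms of smooth functions -/

section Seminorms

variable {d : ℕ} {M : Type*} [TopologicalSpace M]
  [ChartedSpace (EuclideanSpace ℝ (Fin d)) M] [IsManifold (𝓡 d) ∞ M] (g : SmoothMetric d M)

theorem iSup_covNorm_add_le (k : ℕ) (f h : M → ℝ) (hf : ContMDiff (𝓡 d) 𝓘(ℝ, ℝ) k f)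
    (hh : ContMDiff (𝓡 d) 𝓘(ℝ, ℝ) k h) :
    ⨆ x, ENNReal.ofReal (covNorm g (f + h) k x) ≤
      (⨆ x, ENNReal.ofReal (covNorm g f k x)) + ⨆ x, ENNReal.ofReal (covNorm g h k x) := by
  refine iSup_le fun x => (ENNReal.ofReal_le_ofReal (covNorm_add_le g hf hh x)).trans ?_
  rw [ENNReal.ofReal_add (covNorm_nonneg g _ _ _) (covNorm_nonneg g _ _ _)]
  exact add_le_add (le_iSup (fun x => ENNReal.ofReal (covNorm g f k x)) x)
    (le_iSup (fun x => ENNReal.ofReal (covNorm g h k x)) x)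

variable [MeasurableSpace M] {p : ℝ≥0∞}

theorem sobolevNormSmooth_smul (r : ℕ) (c : ℝ) {f : M → ℝ}
    (hf : ContMDiff (𝓡 d) 𝓘(ℝ, ℝ) ∞ f) :
    sobolevNormSmooth g r p (c • f) = ‖c‖ₑ * sobolevNormSmooth g r p f := by
  simp only [sobolevNormSmooth, Finset.mul_sum]
  refine Finset.sum_congr rfl fun k _ => ?_
  rw [show covNorm g (c • f) k = |c| • covNorm g f k from
    funext fun x => covNorm_smul g c (hf.of_le (natCast_le_infty k)) x, eLpNorm_const_smul]
  simp

theorem sobolevNormSmooth_zero (r : ℕ) : sobolevNormSmooth g r p (0 : M → ℝ) = 0 := by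
  have h := sobolevNormSmooth_smul g (p := p) r (0 : ℝ) (f := (0 : M → ℝ)) contMDiff_const
  simpa using h

/-- Through this identity, boundedness on `L^p` becomes the case `r = 0` of the Sobolev estimate. -/
theorem sobolevNormSmooth_zero_order (f : M → ℝ) :
    sobolevNormSmooth g 0 p f = eLpNorm f p (riemannianMeasure g) := by
  simp only [sobolevNormSmooth, zero_add, Finset.sum_range_one]
  refine eLpNorm_congr_norm_ae (Filter.Eventually.of_forall fun x => ?_)
  simp [covNorm_zero_order]

theorem sobolevNorm_le {g : SmoothMetric d M} {r : ℕ} {F : Lp ℝ p (riemannianMeasure g)} {u : ℕ → M → ℝ}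
    (hu : IsSobolevApprox g r p u F) :
    sobolevNorm g r p F ≤ limsup (fun n => sobolevNormSmooth g r p (u n)) atTop :=
  iInf₂_le (f := fun u (_ : IsSobolevApprox g r p u F) =>
    limsup (fun n => sobolevNormSmooth g r p (u n)) atTop) u hu

variable [BorelSpace M] [Fact (1 ≤ p)]

theorem eLpNorm_covNorm_add_le (k : ℕ) (f h : M → ℝ) (hf : ContMDiff (𝓡 d) 𝓘(ℝ, ℝ) k f)
    (hh : ContMDiff (𝓡 d) 𝓘(ℝ, ℝ) k h) :
    eLpNorm (covNorm g (f + h) k) p (riemannianMeasure g) ≤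
      eLpNorm (covNorm g f k) p (riemannianMeasure g) +
        eLpNorm (covNorm g h k) p (riemannianMeasure g) := by
  refine (eLpNorm_mono_real (g := covNorm g f k + covNorm g h k) fun x => ?_).trans
    (eLpNorm_add_le (continuous_covNorm g hf).measurable.aestronglyMeasurable
      (continuous_covNorm g hh).measurable.aestronglyMeasurable Fact.out)
  rw [Real.norm_of_nonneg (covNorm_nonneg g _ _ _)]
  exact covNorm_add_le g hf hh x

theorem sobolevNormSmooth_add_le (r : ℕ) {f h : M → ℝ} (hf : ContMDiff (𝓡 d) 𝓘(ℝ, ℝ) ∞ f)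
    (hh : ContMDiff (𝓡 d) 𝓘(ℝ, ℝ) ∞ h) :
    sobolevNormSmooth g r p (f + h) ≤ sobolevNormSmooth g r p f + sobolevNormSmooth g r p h := by
  simp only [sobolevNormSmooth, ← Finset.sum_add_distrib]
  exact Finset.sum_le_sum fun k _ => eLpNorm_covNorm_add_le g k f h
    (hf.of_le (natCast_le_infty k)) (hh.of_le (natCast_le_infty k))

theorem sobolevNorm_lt_top {g : SmoothMetric d M} {r : ℕ} {F : Lp ℝ p (riemannianMeasure g)}
    (hF : F ∈ sobolevSpace g r p) : sobolevNorm g r p F < ⊤ := by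
  obtain ⟨u, hu⟩ := hF
  refine (sobolevNorm_le hu).trans_lt ?_
  -- The tail of a Cauchy sequence stays within distance 1 of a single term of finite norm.
  obtain ⟨N, hN⟩ := hu.cauchy 1 one_pos
  have hbound : ∀ᶠ n in atTop, sobolevNormSmooth g r p (u n) ≤
      1 + sobolevNormSmooth g r p (u N) := by
    filter_upwards [eventually_ge_atTop N] with n hn
    calc sobolevNormSmooth g r p (u n) = sobolevNormSmooth g r p ((u n - u N) + u N) := by
          rw [sub_add_cancel]
      _ ≤ sobolevNormSmooth g r p (u n - u N) + sobolevNormSmooth g r p (u N) :=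
          sobolevNormSmooth_add_le g r ((hu.smooth n).sub (hu.smooth N)) (hu.smooth N)
      _ ≤ _ := add_le_add (hN n hn N le_rfl).le le_rfl
  exact (limsup_le_of_le (h := hbound)).trans_lt
    (ENNReal.add_lt_top.2 ⟨ENNReal.one_lt_top, hu.finite N⟩)

theorem IsLocalizedHOperator.exists_sobolevNormSmooth_le [T2Space M] {U : Set M} {T : C(M, ℝ) →ₗ[ℝ] C(M, ℝ)}
    (hT : IsLocalizedHOperator d U T) (hp : p ≠ ⊤) (r : ℕ) :
    ∃ c : ℝ≥0, ∀ f : C(M, ℝ), ContMDiff (𝓡 d) 𝓘(ℝ, ℝ) r f →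
      sobolevNormSmooth g r p (T f) ≤ c * sobolevNormSmooth g r p f :=
  hT.exists_sum_le r (fun k f => eLpNorm (covNorm g f k) p (riemannianMeasure g))
    (fun k => by
      rw [show covNorm g (0 : M → ℝ) k = 0 from funext (covNorm_zero_fun g k)]
      exact eLpNorm_zero)
    (eLpNorm_covNorm_add_le g) (fun k H => H.exists_eLpNorm_covNorm_op_le g Fact.out hp k)

end Seminorms

section Spaces

variable {d : ℕ} {M : Type*} [TopologicalSpace M] [CompactSpace M]
  [ChartedSpace (EuclideanSpace ℝ (Fin d)) M] [IsManifold (𝓡 d) ∞ M] (g : SmoothMetric d M)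

/-! ### The spaces `C^r` -/

variable (d M) in
/-- `C^r(M)` as a linear subspace. -/
def crSubmodule (r : ℕ) : Submodule ℝ C(M, ℝ) where
  carrier := crSpace d M r
  zero_mem' := contMDiff_const
  add_mem' hf hh := ContMDiff.add hf hh
  smul_mem' c _ hf := contMDiff_const_smul c hf

theorem crNorm_lt_top {r : ℕ} {f : M → ℝ} (hf : ContMDiff (𝓡 d) 𝓘(ℝ, ℝ) r f) :
    crNorm g r f < ⊤ := by
  refine ENNReal.sum_lt_top.2 fun k hk => ?_
  have hfk : ContMDiff (𝓡 d) 𝓘(ℝ, ℝ) k f :=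
    hf.of_le (by exact_mod_cast Nat.lt_succ_iff.1 (Finset.mem_range.1 hk))
  obtain ⟨b, hb⟩ := (isCompact_range (continuous_covNorm g hfk)).bddAbove
  exact (iSup_le fun x => ENNReal.ofReal_le_ofReal (hb ⟨x, rfl⟩)).trans_lt ENNReal.ofReal_lt_top

theorem crSpace_decomposition {ι : Type*} [Fintype ι] {𝒱 : ι → Set M}
    {P : ι → C(M, ℝ) →ₗ[ℝ] C(M, ℝ)} (hloc : ∀ i, IsLocalizedHOperator d (𝒱 i) (P i))
    (hproj : ∀ i f, P i (P i f) = P i f) (horth : ∀ i j, i ≠ j → ∀ f, P i (P j f) = 0)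
    (hsum : ∀ f, ∑ i, P i f = f) (r : ℕ) :
    IsDirectSumOfImages (crSpace d M r) P ∧
      HasEquivalentNorms (crSpace d M r) (fun f => crNorm g r f) P := by
  have hmap : ∀ i, ∀ f ∈ crSubmodule d M r, P i f ∈ crSubmodule d M r := fun i f hf =>
    (hloc i).contMDiff (natCast_le_infty r) hf
  refine ⟨isDirectSumOfImages_of_forall (crSubmodule d M r) hmap hproj horth hsum,
    hasEquivalentNorms_of_forall (crSubmodule d M r) (fun f hf => crNorm_lt_top g hf) ?_ ?_ hmap ?_
      hsum⟩
  · simp [crNorm, covNorm_zero_fun]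
  · intro f hf h hh
    simp only [crNorm, ← Finset.sum_add_distrib]
    refine Finset.sum_le_sum fun k hk => ?_
    have hkr : (k : ℕ∞ω) ≤ r := by exact_mod_cast Nat.lt_succ_iff.1 (Finset.mem_range.1 hk)
    exact iSup_covNorm_add_le g k f h (ContMDiff.of_le hf hkr) (ContMDiff.of_le hh hkr)
  · intro i
    exact (hloc i).exists_sum_le r (fun k f => ⨆ x, ENNReal.ofReal (covNorm g f k x))
      (fun k => by simp [covNorm_zero_fun]) (iSup_covNorm_add_le g)
      (fun k H => H.exists_iSup_covNorm_op_le g k)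

/-! ### Continuous functions in `L^p` -/

variable [MeasurableSpace M] [BorelSpace M]

/-- The inclusion of `C(M)` into `L^p(M)`. -/
abbrev contToLp (p : ℝ≥0∞) [Fact (1 ≤ p)] : C(M, ℝ) →L[ℝ] Lp ℝ p (riemannianMeasure g) :=
  ContinuousMap.toLp p (riemannianMeasure g) ℝ

variable {p : ℝ≥0∞} [Fact (1 ≤ p)]

theorem enorm_contToLp_sub (f : C(M, ℝ)) (F : Lp ℝ p (riemannianMeasure g)) :
    ‖contToLp g p f - F‖ₑ = eLpNorm (⇑f - ⇑F) p (riemannianMeasure g) := by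
  rw [Lp.enorm_def]
  refine eLpNorm_congr_ae ((Lp.coeFn_sub _ _).trans ?_)
  exact (ContinuousMap.coeFn_toLp (𝕜 := ℝ) (p := p) (riemannianMeasure g) f).sub
    (Filter.EventuallyEq.refl _ _)

theorem enorm_contToLp (f : C(M, ℝ)) :
    ‖contToLp g p f‖ₑ = eLpNorm f p (riemannianMeasure g) := by
  rw [Lp.enorm_def]
  exact eLpNorm_congr_ae (ContinuousMap.coeFn_toLp (𝕜 := ℝ) (p := p) (riemannianMeasure g) f)

theorem isLpExtension_iff {T : C(M, ℝ) →ₗ[ℝ] C(M, ℝ)}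
    {A : Lp ℝ p (riemannianMeasure g) →L[ℝ] Lp ℝ p (riemannianMeasure g)} :
    IsLpExtension T A ↔ ∀ f, A (contToLp g p f) = contToLp g p (T f) := by
  refine ⟨fun h f => Lp.ext ((h f _ (ContinuousMap.coeFn_toLp (𝕜 := ℝ) (p := p) _ f)).trans
    (ContinuousMap.coeFn_toLp (𝕜 := ℝ) (p := p) _ (T f)).symm), fun h f F hF => ?_⟩
  have : F = contToLp g p f :=
    Lp.ext (hF.trans (ContinuousMap.coeFn_toLp (𝕜 := ℝ) (p := p) _ f).symm)
  rw [this, h]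
  exact ContinuousMap.coeFn_toLp (𝕜 := ℝ) (p := p) _ (T f)

/-- `C(M)` embeds in `L^p` and the operators are intertwined by the embedding, so identities between
them descend. -/
theorem continuous_relations_of_lp {ι : Type*} [Fintype ι] {P : ι → C(M, ℝ) →ₗ[ℝ] C(M, ℝ)}
    {A : ι → Lp ℝ p (riemannianMeasure g) →L[ℝ] Lp ℝ p (riemannianMeasure g)}
    (hA : ∀ i f, A i (contToLp g p f) = contToLp g p (P i f))
    (hproj : ∀ i F, A i (A i F) = A i F) (horth : ∀ i j, i ≠ j → ∀ F, A i (A j F) = 0)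
    (hsum : ∀ F, ∑ i, A i F = F) :
    (∀ i f, P i (P i f) = P i f) ∧ (∀ i j, i ≠ j → ∀ f, P i (P j f) = 0) ∧
      ∀ f, ∑ i, P i f = f := by
  have hinj : Function.Injective (contToLp g p) :=
    ContinuousMap.toLp_injective (riemannianMeasure g)
  refine ⟨fun i f => hinj ?_, fun i j hij f => hinj ?_, fun f => hinj ?_⟩
  · rw [← hA, ← hA, hproj]
  · rw [← hA, ← hA, horth i j hij, map_zero]
  · rw [map_sum]
    simp only [← hA, hsum]

theorem sobolevNormSmooth_lt_top (r : ℕ) {f : M → ℝ} (hf : ContMDiff (𝓡 d) 𝓘(ℝ, ℝ) ∞ f) :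
    sobolevNormSmooth g r p f < ⊤ := by
  refine ENNReal.sum_lt_top.2 fun k _ => ?_
  let h : C(M, ℝ) := ⟨covNorm g f k, continuous_covNorm g (hf.of_le (natCast_le_infty k))⟩
  have := enorm_contToLp g (p := p) h
  exact this ▸ enorm_lt_top

/-! ### Sobolev spaces -/

/-- Approximating sequences, as sequences of continuous functions. -/
theorem isSobolevApprox_iff {r : ℕ} {F : Lp ℝ p (riemannianMeasure g)} {u : ℕ → M → ℝ} :
    IsSobolevApprox g r p u F ↔ ∃ v : ℕ → C(M, ℝ), (u = fun n => ⇑(v n)) ∧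
      (∀ n, ContMDiff (𝓡 d) 𝓘(ℝ, ℝ) ∞ (v n)) ∧
      (∀ ε : ℝ≥0∞, 0 < ε → ∃ N, ∀ m ≥ N, ∀ n ≥ N, sobolevNormSmooth g r p (v m - v n : C(M, ℝ)) < ε) ∧
      Tendsto (fun n => contToLp g p (v n)) atTop (𝓝 F) := by
  have htend : ∀ v : ℕ → C(M, ℝ), Tendsto (fun n => contToLp g p (v n)) atTop (𝓝 F) ↔
      Tendsto (fun n => eLpNorm (⇑(v n) - ⇑F) p (riemannianMeasure g)) atTop (𝓝 0) := by
    intro v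
    simp only [← enorm_contToLp_sub]
    rw [tendsto_iff_edist_tendsto_0]
    simp only [edist_eq_enorm_sub]
  constructor
  · intro h
    refine ⟨fun n => ⟨u n, (h.smooth n).continuous⟩, rfl, h.smooth, h.cauchy, ?_⟩
    exact (htend _).2 h.tendsto
  · rintro ⟨v, rfl, hs, hc, ht⟩
    exact ⟨hs, fun n => sobolevNormSmooth_lt_top g r (hs n), hc, (htend v).1 ht⟩

variable {g}

theorem IsSobolevApprox.add {r : ℕ} {F G : Lp ℝ p (riemannianMeasure g)} {u v : ℕ → M → ℝ}
    (hu : IsSobolevApprox g r p u F) (hv : IsSobolevApprox g r p v G) :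
    IsSobolevApprox g r p (fun n => u n + v n) (F + G) := by
  obtain ⟨u, rfl, hus, huc, hut⟩ := (isSobolevApprox_iff g).1 hu
  obtain ⟨v, rfl, hvs, hvc, hvt⟩ := (isSobolevApprox_iff g).1 hv
  refine (isSobolevApprox_iff g).2 ⟨fun n => u n + v n, rfl, fun n => (hus n).add (hvs n),
    fun ε hε => ?_, by simpa only [map_add] using hut.add hvt⟩
  obtain ⟨N, hN⟩ := huc (ε / 2) (ENNReal.half_pos hε.ne')
  obtain ⟨N', hN'⟩ := hvc (ε / 2) (ENNReal.half_pos hε.ne')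
  refine ⟨max N N', fun m hm n hn => ?_⟩
  have h1 : (((u m + v m) - (u n + v n) : C(M, ℝ)) : M → ℝ) = ⇑(u m - u n) + ⇑(v m - v n) := by
    ext x
    simp
    ring
  rw [h1, ← ENNReal.add_halves ε]
  exact (sobolevNormSmooth_add_le g r ((hus m).sub (hus n)) ((hvs m).sub (hvs n))).trans_lt
    (ENNReal.add_lt_add (hN m ((le_max_left _ _).trans hm) n ((le_max_left _ _).trans hn))
      (hN' m ((le_max_right _ _).trans hm) n ((le_max_right _ _).trans hn)))

theorem IsSobolevApprox.zero (r : ℕ) :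
    IsSobolevApprox g r p (fun _ => 0) (0 : Lp ℝ p (riemannianMeasure g)) :=
  (isSobolevApprox_iff g).2 ⟨fun _ => 0, rfl, fun _ => contMDiff_const,
    fun ε hε => ⟨0, fun m _ n _ => by
      rw [sub_zero, ContinuousMap.coe_zero, sobolevNormSmooth_zero]; exact hε⟩,
    by simp⟩

/-- Operators that are bounded in the Sobolev norm of smooth functions map approximating sequences
to approximating sequences. -/
theorem IsSobolevApprox.map {r : ℕ} {F : Lp ℝ p (riemannianMeasure g)} {u : ℕ → M → ℝ}
    {T : C(M, ℝ) →ₗ[ℝ] C(M, ℝ)}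
    {A : Lp ℝ p (riemannianMeasure g) →L[ℝ] Lp ℝ p (riemannianMeasure g)}
    (hA : ∀ f, A (contToLp g p f) = contToLp g p (T f))
    (hs : ∀ f : C(M, ℝ), ContMDiff (𝓡 d) 𝓘(ℝ, ℝ) ∞ f → ContMDiff (𝓡 d) 𝓘(ℝ, ℝ) ∞ (T f))
    {c : ℝ≥0} (hc : ∀ f : C(M, ℝ), ContMDiff (𝓡 d) 𝓘(ℝ, ℝ) ∞ f →
      sobolevNormSmooth g r p (T f) ≤ c * sobolevNormSmooth g r p f)
    (hu : IsSobolevApprox g r p u F) :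
    ∃ v, IsSobolevApprox g r p v (A F) ∧
      ∀ n, sobolevNormSmooth g r p (v n) ≤ c * sobolevNormSmooth g r p (u n) := by
  obtain ⟨u, rfl, hus, huc, hut⟩ := (isSobolevApprox_iff g).1 hu
  refine ⟨fun n => T (u n), (isSobolevApprox_iff g).2 ⟨fun n => T (u n), rfl, fun n => hs _ (hus n),
    fun ε hε => ?_, ?_⟩, fun n => hc _ (hus n)⟩
  -- Division by `c + 1` rather than `c` covers the case `c = 0`.
  · obtain ⟨N, hN⟩ := huc (ε / (c + 1)) (ENNReal.div_pos hε.ne' (by finiteness))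
    refine ⟨N, fun m hm n hn => ?_⟩
    rw [← map_sub]
    calc sobolevNormSmooth g r p (T (u m - u n))
        ≤ c * sobolevNormSmooth g r p (u m - u n : C(M, ℝ)) := hc _ ((hus m).sub (hus n))
      _ ≤ (c + 1) * sobolevNormSmooth g r p (u m - u n : C(M, ℝ)) := by gcongr; simp
      _ < (c + 1) * (ε / (c + 1)) :=
          (ENNReal.mul_lt_mul_iff_right (by simp) (by finiteness)).2 (hN m hm n hn)
      _ ≤ ε := ENNReal.mul_div_le
  · simpa only [Function.comp_def, hA] using (A.continuous.tendsto F).comp hut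

/-- Multiplication by `a` is itself an operator bounded in the Sobolev norm, so stability under
bounded operators applies. -/
theorem IsSobolevApprox.const_smul {r : ℕ} {F : Lp ℝ p (riemannianMeasure g)} {u : ℕ → M → ℝ}
    (hu : IsSobolevApprox g r p u F) (a : ℝ) : a • F ∈ sobolevSpace g r p := by
  set A : Lp ℝ p (riemannianMeasure g) →L[ℝ] Lp ℝ p (riemannianMeasure g) :=
    a • ContinuousLinearMap.id ℝ _ with hAdef
  set T : C(M, ℝ) →ₗ[ℝ] C(M, ℝ) := a • LinearMap.id with hTdef
  have hA : ∀ f, A (contToLp g p f) = contToLp g p (T f) := fun f =>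
    (map_smul (contToLp g p) a f).symm
  obtain ⟨v, hv, -⟩ := hu.map hA (c := ‖a‖₊) (fun f hf => contMDiff_const_smul a hf)
    (fun f hf => (sobolevNormSmooth_smul g r a hf).le)
  exact ⟨v, hv⟩

variable (g p) in
/-- `W^r_p(M)` as a linear subspace of `L^p(M)`. -/
def sobolevSubmodule (r : ℕ) : Submodule ℝ (Lp ℝ p (riemannianMeasure g)) where
  carrier := sobolevSpace g r p
  zero_mem' := ⟨_, IsSobolevApprox.zero r⟩
  add_mem' := fun ⟨_, hu⟩ ⟨_, hv⟩ => ⟨_, hu.add hv⟩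
  smul_mem' := fun a _ ⟨_, hu⟩ => hu.const_smul a

theorem sobolevNorm_zero (r : ℕ) : sobolevNorm g r p (0 : Lp ℝ p (riemannianMeasure g)) = 0 := by
  refine le_antisymm ((sobolevNorm_le (IsSobolevApprox.zero r)).trans ?_) (zero_le)
  simp [sobolevNormSmooth_zero]

theorem sobolevNorm_add_le (r : ℕ) (F G : Lp ℝ p (riemannianMeasure g)) :
    sobolevNorm g r p (F + G) ≤ sobolevNorm g r p F + sobolevNorm g r p G := by
  refine ENNReal.le_iInf₂_add_iInf₂ fun u hu v hv => (sobolevNorm_le (hu.add hv)).trans ?_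
  refine le_trans (limsup_le_limsup (Filter.Eventually.of_forall fun n => ?_))
    (ennreal_limsup_add_le _ _)
  exact sobolevNormSmooth_add_le g r (hu.smooth n) (hv.smooth n)

/-! ### Extension to `L^p` and decomposition of Sobolev spaces -/

variable [T2Space M]

/-- A compact manifold is second countable, which supplies the regularity of the finite measure
needed for density in `L^p`, `p < ∞`. -/
theorem denseRange_contToLp (hp : p ≠ ⊤) : DenseRange (contToLp (M := M) g p) := by
  have : SecondCountableTopology M :=
    ChartedSpace.secondCountable_of_sigmaCompact (EuclideanSpace ℝ (Fin d)) M
  exact ContinuousMap.toLp_denseRange ℝ (riemannianMeasure g) ℝ hp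

theorem IsLocalizedHOperator.exists_isLpExtension {U : Set M} {T : C(M, ℝ) →ₗ[ℝ] C(M, ℝ)}
    (hT : IsLocalizedHOperator d U T) (hp : p ≠ ⊤) :
    ∃ A : Lp ℝ p (riemannianMeasure g) →L[ℝ] Lp ℝ p (riemannianMeasure g),
      ∀ f, A (contToLp g p f) = contToLp g p (T f) := by
  -- At order 0 the estimate needs continuity only, hence bounds `T` in the `L^p` norm on all of
  -- `C(M)`; extension from a dense range follows.
  obtain ⟨c, hc⟩ := hT.exists_sobolevNormSmooth_le g hp 0
  have hbound : ∀ f, ‖contToLp g p (T f)‖ ≤ c * ‖contToLp g p f‖ := by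
    intro f
    have h := hc f (contMDiff_zero_iff.2 f.continuous)
    rw [sobolevNormSmooth_zero_order, sobolevNormSmooth_zero_order, ← enorm_contToLp,
      ← enorm_contToLp] at h
    simpa using ENNReal.toReal_mono (by finiteness) h
  set E : C(M, ℝ) →ₗ[ℝ] Lp ℝ p (riemannianMeasure g) := (contToLp g p).toLinearMap
  have hd : DenseRange E := denseRange_contToLp hp
  exact ⟨(E ∘ₗ T).extendOfNorm E, LinearMap.extendOfNorm_eq hd ⟨c, hbound⟩⟩

/-- Relations on `C(M)` are inherited by the extensions to `L^p(M)`. -/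
theorem lp_relations {ι : Type*} [Fintype ι] {P : ι → C(M, ℝ) →ₗ[ℝ] C(M, ℝ)} (hp : p ≠ ⊤)
    {A : ι → Lp ℝ p (riemannianMeasure g) →L[ℝ] Lp ℝ p (riemannianMeasure g)}
    (hA : ∀ i f, A i (contToLp g p f) = contToLp g p (P i f))
    (hproj : ∀ i f, P i (P i f) = P i f) (horth : ∀ i j, i ≠ j → ∀ f, P i (P j f) = 0)
    (hsum : ∀ f, ∑ i, P i f = f) :
    (∀ i F, A i (A i F) = A i F) ∧ (∀ i j, i ≠ j → ∀ F, A i (A j F) = 0) ∧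
      ∀ F, ∑ i, A i F = F := by
  have hd : DenseRange (contToLp g p) := denseRange_contToLp hp
  refine ⟨fun i F => ?_, fun i j hij F => ?_, fun F => ?_⟩
  · refine congrFun (DenseRange.equalizer hd (g := fun F => A i (A i F)) (h := fun F => A i F)
      (by fun_prop) (by fun_prop) ?_) F
    ext1 f
    simp only [Function.comp_apply, hA, hproj]
  · refine congrFun (DenseRange.equalizer hd (g := fun F => A i (A j F)) (h := fun _ => 0)
      (by fun_prop) (by fun_prop) ?_) F
    ext1 f
    simp only [Function.comp_apply, hA, horth i j hij, map_zero]
  · refine congrFun (DenseRange.equalizer hd (g := fun F => ∑ i, A i F) (h := fun F => F)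
      (by fun_prop) (by fun_prop) ?_) F
    ext1 f
    simp only [Function.comp_apply, hA]
    rw [← map_sum, hsum]

theorem IsLocalizedHOperator.sobolev_bound {U : Set M} {T : C(M, ℝ) →ₗ[ℝ] C(M, ℝ)}
    (hT : IsLocalizedHOperator d U T) (hp : p ≠ ⊤) (r : ℕ)
    {A : Lp ℝ p (riemannianMeasure g) →L[ℝ] Lp ℝ p (riemannianMeasure g)}
    (hA : ∀ f, A (contToLp g p f) = contToLp g p (T f)) :
    (∀ F ∈ sobolevSpace g r p, A F ∈ sobolevSpace g r p) ∧
      ∃ c : ℝ≥0, ∀ F, sobolevNorm g r p (A F) ≤ c * sobolevNorm g r p F := by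
  obtain ⟨c, hc⟩ := hT.exists_sobolevNormSmooth_le g hp r
  -- The constant is enlarged to `c + 1` so as to be nonzero: it can then be moved across the
  -- infimum by division, also when `F` has no approximating sequence and its norm is infinite.
  have hmap := fun {F : Lp ℝ p (riemannianMeasure g)} {u : ℕ → M → ℝ}
    (hu : IsSobolevApprox g r p u F) => hu.map hA (c := c + 1)
      (fun f hf => hT.contMDiff le_rfl hf)
      (fun f hf => (hc f (hf.of_le (natCast_le_infty r))).trans (by gcongr; simp))
  refine ⟨fun F ⟨u, hu⟩ => ?_, c + 1, fun F => ?_⟩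
  · obtain ⟨v, hv, -⟩ := hmap hu
    exact ⟨v, hv⟩
  · have hc0 : ((c + 1 : ℝ≥0) : ℝ≥0∞) ≠ 0 := by simp
    rw [mul_comm, ← ENNReal.div_le_iff_le_mul (Or.inl hc0) (Or.inl ENNReal.coe_ne_top)]
    refine le_iInf₂ fun u hu => ?_
    rw [ENNReal.div_le_iff_le_mul (Or.inl hc0) (Or.inl ENNReal.coe_ne_top)]
    obtain ⟨v, hv, hle⟩ := hmap hu
    refine (sobolevNorm_le hv).trans ?_
    rw [mul_comm, ← ENNReal.limsup_const_mul_of_ne_top ENNReal.coe_ne_top]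
    exact limsup_le_limsup (Filter.Eventually.of_forall hle)

theorem sobolevSpace_decomposition {ι : Type*} [Fintype ι] {𝒱 : ι → Set M}
    {P : ι → C(M, ℝ) →ₗ[ℝ] C(M, ℝ)} (hloc : ∀ i, IsLocalizedHOperator d (𝒱 i) (P i))
    (hp : p ≠ ⊤)
    {A : ι → Lp ℝ p (riemannianMeasure g) →L[ℝ] Lp ℝ p (riemannianMeasure g)}
    (hA : ∀ i f, A i (contToLp g p f) = contToLp g p (P i f))
    (hproj : ∀ i f, P i (P i f) = P i f) (horth : ∀ i j, i ≠ j → ∀ f, P i (P j f) = 0)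
    (hsum : ∀ f, ∑ i, P i f = f) (r : ℕ) :
    IsDirectSumOfImages (sobolevSpace g r p) (fun i => (A i).toLinearMap) ∧
      HasEquivalentNorms (sobolevSpace g r p) (sobolevNorm g r p)
        (fun i => (A i).toLinearMap) := by
  obtain ⟨hproj', horth', hsum'⟩ := lp_relations hp hA hproj horth hsum
  have hbound := fun i => (hloc i).sobolev_bound hp r (hA i)
  refine ⟨isDirectSumOfImages_of_forall (sobolevSubmodule g p r) (fun i => (hbound i).1) hproj'
    horth' hsum', hasEquivalentNorms_of_forall (sobolevSubmodule g p r)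
    (fun F hF => sobolevNorm_lt_top hF) (sobolevNorm_zero r)
    (fun F _ G _ => sobolevNorm_add_le r F G) (fun i => (hbound i).1) (fun i => ?_) hsum'⟩
  obtain ⟨c, hc⟩ := (hbound i).2
  exact ⟨c, fun F _ => hc F⟩

end Spaces

end HestenesDecomposition

end

/-! ### Assembly of the theorem -/

open HestenesDecomposition in
theorem mainTheorem8 {d : ℕ} {M : Type*} [TopologicalSpace M] [T2Space M] [CompactSpace M]
    [ChartedSpace (EuclideanSpace ℝ (Fin d)) M] [IsManifold (𝓡 d) ∞ M]
    [MeasurableSpace M] [BorelSpace M]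
    (g : SmoothMetric d M)
    (𝒰 : Set (Set M)) [Fintype 𝒰]
    (h_open : ∀ U ∈ 𝒰, IsOpen U) (h_cover : ⋃₀ 𝒰 = Set.univ)
    (P : 𝒰 → C(M, ℝ) →ₗ[ℝ] C(M, ℝ))
    (hP : (∃ (q : ℝ≥0∞) (_ : Fact (1 ≤ q)), q ≠ ⊤ ∧ IsSmoothDecompositionLp g q 𝒰 P) ∨
      IsSmoothDecompositionC d 𝒰 P) :
    (∀ r : ℕ,
      IsDirectSumOfImages (crSpace d M r) P ∧
      HasEquivalentNorms (crSpace d M r) (fun f => crNorm g r f) P) ∧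
    (∀ (p : ℝ≥0∞) [Fact (1 ≤ p)], p ≠ ⊤ →
      ∃! A : 𝒰 → Lp ℝ p (riemannianMeasure g) →L[ℝ] Lp ℝ p (riemannianMeasure g),
        (∀ U, IsLpExtension (P U) (A U)) ∧
        ∀ r : ℕ,
          IsDirectSumOfImages (sobolevSpace g r p) (fun U => (A U).toLinearMap) ∧
          HasEquivalentNorms (sobolevSpace g r p) (sobolevNorm g r p)
            (fun U => (A U).toLinearMap)) := by
  have hloc : ∀ U : 𝒰, IsLocalizedHOperator d (U : Set M) (P U) := by
    rcases hP with ⟨q, _, _, h⟩ | h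
    · exact h.family.localized
    · exact h.family.localized
  obtain ⟨hproj, horth, hsum⟩ : (∀ U f, P U (P U f) = P U f) ∧
      (∀ U U', U ≠ U' → ∀ f, P U (P U' f) = 0) ∧ ∀ f, ∑ U, P U f = f := by
    -- Whichever space carries the hypothesis, the relations are brought to `C(M)`. As the cover is
    -- finite, the convergent sums over it are finite sums.
    rcases hP with ⟨q, _, _, h⟩ | h
    · obtain ⟨A, hA, hproj, horth, hsum, -⟩ := h.extension
      exact continuous_relations_of_lp g (fun U => (isLpExtension_iff g).1 (hA U)) hproj horth
        fun F => (hasSum_fintype _).unique (hsum F)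
    · exact ⟨h.proj, h.comp_eq_zero, fun f => (hasSum_fintype _).unique (h.hasSum f)⟩
  refine ⟨crSpace_decomposition g hloc hproj horth hsum, fun p _ hp => ?_⟩
  choose A hA using fun U => (hloc U).exists_isLpExtension hp
  refine ⟨A, ⟨fun U => (isLpExtension_iff g).2 (hA U),
    sobolevSpace_decomposition hloc hp hA hproj horth hsum⟩, fun B hB => funext fun U => ?_⟩
  -- Uniqueness needs only the extension property: two continuous operators that agree on the dense
  -- image of `C(M)` coincide.
  refine ContinuousLinearMap.ext fun F => congrFun ((denseRange_contToLp hp).equalizer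
    (B U).continuous (A U).continuous (funext fun f => ?_)) F
  exact ((isLpExtension_iff g).1 (hB.1 U) f).trans (hA U f).symm
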